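/- Conventions. All modules are left modules unless otherwise stated, and $\mathrm{mod}\,\Lambda$ denotes the finitely generated modules over a ring $\Lambda$. An Artin algebra is an algebra that is finitely generated as a module over a commutative artinian ring. Let $\Lambda$ be an Artin algebra. For $X\in\mathrm{mod}\,\Lambda$ let $\Omega X$ be its syzygy, the kernel of a projective cover of $X$. For a class $\mathcal D\subseteq\mathrm{mod}\,\Lambda$ let $\mathrm{add}\,\mathcal D$ be the class of direct summands of finite direct sums of modules in $\mathcal D$. Let $K$ be the free abelian group on the isomorphism classes $[X]$ of indecomposable non-projective modules in $\mathrm{mod}\,\Lambda$; any $X\in \mathrm{mod}\,\Lambda$ has a class $[X]\in K$, the sum of the classes of the non-projective summands in its Krull–Schmidt decomposition. Let $L:K\to K$ be the endomorphism with $L[X]=[\Omega X]$, let $\langle X\rangle\le K$ be the subgroup generated by the classes of the indecomposable non-projective direct summands of $X$, and let $$\Phi(X)=\min\{n\ge 0:\ \mathrm{rk}\,L^k\langle X\rangle=\mathrm{rk}\,L^{k+1}\langle X\rangle\ \text{ for all } k\ge n\}.$$ For an integer $n\ge 0$, a class $\mathcal C\subseteq\mathrm{mod}\,\Lambda$ is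 an $n$-GLIT class if there are an integer $t\ge1$, a module $V\in\mathrm{mod}\,\Lambda$ and a class $\mathcal D\subseteq\mathrm{mod}\,\Lambda$ with $\mathrm{add}\,\mathcal D=\mathcal D$, $\Omega^t(\mathcal D)\subseteq\mathcal D$ and $\sup_{D\in\mathcal D}\Phi(D)<\infty$, such that every $C\in\mathcal C$ admits an exact sequence $0\to V_1\oplus D_1\to V_0\oplus D_0\to\Omega^nC\to0$ with $V_0,V_1\in\mathrm{add}\,V$ and $D_0,D_1\in\mathcal D$. The algebra $\Lambda$ is special GLIT if the class of all modules in $\mathrm{mod}\,\Lambda$ of finite projective dimension is a $0$-GLIT class. Finally $\mathrm{fin.dim}\,\Lambda\in\{0,1,2,\dots,\infty\}$ is the supremum of the finite projective dimensions of modules in $\mathrm{mod}\,\Lambda$ (zero modules are ignored, and the supremum is $0$ if there are no others). **Theorem.** Let $T$ and $U$ be Artin algebras and let $\mathcal M=(T,N,M,U,\alpha,\beta)$ be a Morita context: $M$ is a $U$-$T$-bimodule, $N$ is a $T$-$U$-bimodule, and $\alpha:M\otimes_TN\to U$ and $\beta:N\otimes_UM\to T$ are bimodule homomorphisms with $\alpha(m\otimes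 n)m'=m\,\beta(n\otimes m')$ and $\beta(n\otimes m)n'=n\,\alpha(m\otimes n')$ for all $m,m'\in M$ and $n,n'\in N$. Let $$\Lambda_{\mathcal M}=\begin{pmatrix}T&N\\M&U\end{pmatrix},\qquad \begin{pmatrix}t&n\\m&u\end{pmatrix}\begin{pmatrix}t'&n'\\m'&u'\end{pmatrix}=\begin{pmatrix}tt'+\beta(n\otimes m')&tn'+nu'\\mt'+um'&\alpha(m\otimes n')+uu'\end{pmatrix}$$ be its Morita ring, and assume that $\Lambda_{\mathcal M}$ is an Artin algebra. Suppose that ${}_UM$, $M_T$, ${}_TN$ and $N_U$ are projective modules and that $M\otimes_TN=0=N\otimes_UM$. Then $\Lambda_{\mathcal M}$ is special GLIT if and only if both $T$ and $U$ are special GLIT. Moreover $$\max\{\mathrm{fin.dim}\,T,\mathrm{fin.dim}\,U\}\le\mathrm{fin.dim}\,\Lambda_{\mathcal M}\le\max\{\mathrm{fin.dim}\,T,\mathrm{fin.dim}\,U\}+2 .$$ -/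

import Mathlib

universe u

open CategoryTheory CategoryTheory.Limits

noncomputable section

namespace GLIT

/-! ### Artin algebras -/

/-- `A` is an Artin algebra: a finitely generated algebra (as a module) over some commutative
artinian ring. -/
def IsArtinAlgebra (A : Type u) [Ring A] : Prop :=
  ∃ (R : Type u) (_ : CommRing R) (_ : Algebra R A), IsArtinianRing R ∧ Module.Finite R A

/-! ### Morita contexts and Morita rings -/

section Morita

set_option linter.unusedSectionVars false

/-- The tensor product `M ⊗_T N` of a right `T`-module `M` (a left module over the opposite ring)
and a left `T`-module `N` over a possibly noncommutative ring `T`, as an abelian group: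
the quotient of `M ⊗_ℤ N` by the relations `mt ⊗ n = m ⊗ tn`. -/
abbrev BalancedTensor (T M N : Type u) [Ring T] [AddCommGroup M] [AddCommGroup N]
    [Module Tᵐᵒᵖ M] [Module T N] : Type u :=
  TensorProduct ℤ M N ⧸ AddSubgroup.closure
    {x : TensorProduct ℤ M N | ∃ (m : M) (t : T) (n : N),
      x = TensorProduct.tmul ℤ (MulOpposite.op t • m) n - TensorProduct.tmul ℤ m (t • n)}

/-- The pure tensor `m ⊗ n` in `M ⊗_T N`. -/
def btmul (T : Type u) {M N : Type u} [Ring T] [AddCommGroup M] [AddCommGroup N]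
    [Module Tᵐᵒᵖ M] [Module T N] (m : M) (n : N) : BalancedTensor T M N :=
  QuotientAddGroup.mk (TensorProduct.tmul ℤ m n)

variable (T N M U : Type u) [Ring T] [Ring U] [AddCommGroup M] [AddCommGroup N]
  [Module U M] [Module Tᵐᵒᵖ M] [SMulCommClass U Tᵐᵒᵖ M]
  [Module T N] [Module Uᵐᵒᵖ N] [SMulCommClass T Uᵐᵒᵖ N]

/-- A Morita context `(T, N, M, U, α, β)`: `M` is a `U`-`T`-bimodule, `N` is a `T`-`U`-bimodule,
`α : M ⊗_T N → U` and `β : N ⊗_U M → T` are bimodule homomorphisms satisfying the two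
associativity conditions. -/
structure MoritaContext where
  α : BalancedTensor T M N →+ U
  β : BalancedTensor U N M →+ T
  α_left : ∀ (u : U) (m : M) (n : N), α (btmul T (u • m) n) = u * α (btmul T m n)
  α_right : ∀ (m : M) (n : N) (u : U),
    α (btmul T m (MulOpposite.op u • n)) = α (btmul T m n) * u
  β_left : ∀ (t : T) (n : N) (m : M), β (btmul U (t • n) m) = t * β (btmul U n m)
  β_right : ∀ (n : N) (m : M) (t : T),
    β (btmul U n (MulOpposite.op t • m)) = β (btmul U n m) * t
  assoc_M : ∀ (m m' : M) (n : N),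
    α (btmul T m n) • m' = MulOpposite.op (β (btmul U n m')) • m
  assoc_N : ∀ (n n' : N) (m : M),
    β (btmul U n m) • n' = MulOpposite.op (α (btmul T m n')) • n

variable {T N M U}

/-- The underlying type of the Morita ring: formal `2 × 2` matrices with rows `(t, n)` and
`(m, u)`. -/
@[ext] structure MoritaRing (c : MoritaContext T N M U) : Type u where
  t : T
  n : N
  m : M
  u : U

section btmul

variable (T) in
theorem btmul_add (m : M) (n n' : N) : btmul T m (n + n') = btmul T m n + btmul T m n' := by
  simp [btmul, TensorProduct.tmul_add]

variable (T) in
theorem add_btmul (m m' : M) (n : N) : btmul T (m + m') n = btmul T m n + btmul T m' n := by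
  simp [btmul, TensorProduct.add_tmul]

variable (T) in
theorem btmul_zero (m : M) : btmul T m (0 : N) = 0 := by
  simp [btmul]

variable (T) in
theorem zero_btmul (n : N) : btmul T (0 : M) n = 0 := by
  simp [btmul]

theorem smul_btmul (m : M) (t : T) (n : N) :
    btmul T (MulOpposite.op t • m) n = btmul T m (t • n) := by
  rw [btmul, btmul, ← sub_eq_zero, ← QuotientAddGroup.mk_sub]
  exact (QuotientAddGroup.eq_zero_iff _).2 (AddSubgroup.subset_closure ⟨m, t, n, rfl⟩)

end btmul

namespace MoritaRing

variable {c : MoritaContext T N M U}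

instance : Zero (MoritaRing c) := ⟨⟨0, 0, 0, 0⟩⟩
instance : One (MoritaRing c) := ⟨⟨1, 0, 0, 1⟩⟩
instance : Add (MoritaRing c) := ⟨fun x y => ⟨x.t + y.t, x.n + y.n, x.m + y.m, x.u + y.u⟩⟩
instance : Neg (MoritaRing c) := ⟨fun x => ⟨-x.t, -x.n, -x.m, -x.u⟩⟩

/-- Matrix multiplication. -/
instance : Mul (MoritaRing c) := ⟨fun x y =>
  ⟨x.t * y.t + c.β (btmul U x.n y.m),
   x.t • y.n + MulOpposite.op y.u • x.n,
   MulOpposite.op y.t • x.m + x.u • y.m,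
   c.α (btmul T x.m y.n) + x.u * y.u⟩⟩

@[simp] theorem zero_t : (0 : MoritaRing c).t = 0 := rfl
@[simp] theorem zero_n : (0 : MoritaRing c).n = 0 := rfl
@[simp] theorem zero_m : (0 : MoritaRing c).m = 0 := rfl
@[simp] theorem zero_u : (0 : MoritaRing c).u = 0 := rfl
@[simp] theorem one_t : (1 : MoritaRing c).t = 1 := rfl
@[simp] theorem one_n : (1 : MoritaRing c).n = 0 := rfl
@[simp] theorem one_m : (1 : MoritaRing c).m = 0 := rfl
@[simp] theorem one_u : (1 : MoritaRing c).u = 1 := rfl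
@[simp] theorem add_t (x y : MoritaRing c) : (x + y).t = x.t + y.t := rfl
@[simp] theorem add_n (x y : MoritaRing c) : (x + y).n = x.n + y.n := rfl
@[simp] theorem add_m (x y : MoritaRing c) : (x + y).m = x.m + y.m := rfl
@[simp] theorem add_u (x y : MoritaRing c) : (x + y).u = x.u + y.u := rfl
@[simp] theorem neg_t (x : MoritaRing c) : (-x).t = -x.t := rfl
@[simp] theorem neg_n (x : MoritaRing c) : (-x).n = -x.n := rfl
@[simp] theorem neg_m (x : MoritaRing c) : (-x).m = -x.m := rfl
@[simp] theorem neg_u (x : MoritaRing c) : (-x).u = -x.u := rfl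
@[simp] theorem mul_t (x y : MoritaRing c) :
    (x * y).t = x.t * y.t + c.β (btmul U x.n y.m) := rfl
@[simp] theorem mul_n (x y : MoritaRing c) :
    (x * y).n = x.t • y.n + MulOpposite.op y.u • x.n := rfl
@[simp] theorem mul_m (x y : MoritaRing c) :
    (x * y).m = MulOpposite.op y.t • x.m + x.u • y.m := rfl
@[simp] theorem mul_u (x y : MoritaRing c) :
    (x * y).u = c.α (btmul T x.m y.n) + x.u * y.u := rfl

protected theorem mul_assoc' (x y z : MoritaRing c) : x * y * z = x * (y * z) := by
  ext
  · simp only [mul_t, mul_n, mul_m, add_btmul, btmul_add, map_add, c.β_left, c.β_right,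
      smul_btmul, add_mul, mul_add, mul_assoc]
    abel
  · simp only [mul_t, mul_n, mul_u, add_smul, smul_add, mul_smul, MulOpposite.op_add,
      MulOpposite.op_mul, c.assoc_N, smul_comm (x.t) (MulOpposite.op z.u) y.n]
    abel
  · simp only [mul_t, mul_m, mul_u, add_smul, smul_add, mul_smul, MulOpposite.op_add,
      MulOpposite.op_mul, c.assoc_M, smul_comm (x.u) (MulOpposite.op z.t) y.m]
    abel
  · simp only [mul_u, mul_n, mul_m, add_btmul, btmul_add, map_add, c.α_left, c.α_right,
      smul_btmul, add_mul, mul_add, mul_assoc]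
    abel

/-- The Morita ring of a Morita context. -/
instance : Ring (MoritaRing c) where
  add_assoc x y z := by ext <;> simp [add_assoc]
  zero_add x := by ext <;> simp
  add_zero x := by ext <;> simp
  add_comm x y := by ext <;> simp [add_comm]
  neg_add_cancel x := by ext <;> simp
  mul_assoc := MoritaRing.mul_assoc'
  one_mul x := by ext <;> simp [zero_btmul]
  mul_one x := by ext <;> simp [btmul_zero]
  zero_mul x := by ext <;> simp [zero_btmul]
  mul_zero x := by ext <;> simp [btmul_zero]
  left_distrib x y z := by
    ext <;> simp only [mul_t, mul_n, mul_m, mul_u, add_t, add_n, add_m, add_u, btmul_add,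
      map_add, mul_add, smul_add, MulOpposite.op_add, add_smul] <;> abel
  right_distrib x y z := by
    ext <;> simp only [mul_t, mul_n, mul_m, mul_u, add_t, add_n, add_m, add_u, add_btmul,
      map_add, add_mul, smul_add, add_smul] <;> abel
  nsmul := nsmulRec
  zsmul := zsmulRec

end MoritaRing

end Morita

/-! ### Finitely generated modules, projective dimension, finitistic dimension -/

section Modules

variable (A : Type u) [Ring A]

/-- The class `mod A` of finitely generated left `A`-modules. -/
def fgMod : ObjectProperty (ModuleCat.{u} A) := fun X => Module.Finite A X

variable {A}

/-- `𝒫^{<∞}(𝒞)`: the modules in `𝒞` of finite projective dimension. -/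
def finPD (C : ObjectProperty (ModuleCat.{u} A)) : ObjectProperty (ModuleCat.{u} A) :=
  fun X => C X ∧ projectiveDimension X ≠ ⊤

variable (A) in
/-- The finitistic dimension of `A`: the supremum (possibly `⊤`) of the finite projective
dimensions of finitely generated left `A`-modules. (The zero module, whose projective dimension
is `⊥`, does not contribute.) -/
def finDim : ℕ∞ :=
  sSup {d : ℕ∞ | d ≠ ⊤ ∧ ∃ X : ModuleCat.{u} A, fgMod A X ∧
    projectiveDimension X = (d : WithBot ℕ∞)}

/-! ### Projective covers and syzygies -/

/-- A projective cover of `X`: a surjection from a projective module with superfluous kernel. -/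
structure ProjCover (X : ModuleCat.{u} A) where
  P : ModuleCat.{u} A
  projective : Projective P
  p : P ⟶ X
  surjective : Function.Surjective p.hom
  superfluous : ∀ S : Submodule A P, S ⊔ LinearMap.ker p.hom = ⊤ → S = ⊤

open Classical in
/-- The syzygy `Ω X`: the kernel of a projective cover of `X` (which exists for every finitely
generated module over an Artin algebra, and is then unique up to isomorphism). -/
def syzygy (X : ModuleCat.{u} A) : ModuleCat.{u} A :=
  if h : Nonempty (ProjCover X) then ModuleCat.of A (LinearMap.ker h.some.p.hom)
  else ModuleCat.of A PUnit

/-! ### The Igusa-Todorov function `Φ` -/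

variable (A) in
/-- Finitely generated indecomposable non-projective modules. -/
def IndecNonProj : Type (u + 1) :=
  {X : ModuleCat.{u} A // fgMod A X ∧ Indecomposable X ∧ ¬ Projective X}

variable (A) in
/-- Isomorphism of such modules. -/
def isoSetoid : Setoid (IndecNonProj A) where
  r X Y := Nonempty (X.1 ≅ Y.1)
  iseqv := ⟨fun _ => ⟨Iso.refl _⟩, fun ⟨e⟩ => ⟨e.symm⟩, fun ⟨e⟩ ⟨f⟩ => ⟨e.trans f⟩⟩

variable (A) in
/-- The free abelian group on the isomorphism classes of finitely generated indecomposable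
non-projective modules. -/
abbrev KProj : Type (u + 1) := _root_.Quotient (isoSetoid A) →₀ ℤ

/-- The basis element `[X]` for `X` indecomposable and non-projective. -/
def basisClass (X : IndecNonProj A) : KProj A := Finsupp.single (_root_.Quotient.mk (isoSetoid A) X) 1

/-- A decomposition of `X` as a finite direct sum of finitely generated indecomposables. -/
structure Decomposition (X : ModuleCat.{u} A) where
  n : ℕ
  Y : Fin n → ModuleCat.{u} A
  fg : ∀ i, fgMod A (Y i)
  indec : ∀ i, Indecomposable (Y i)
  iso : X ≅ ⨁ Y

open Classical in
/-- The class `[X]` of a finitely generated module: the sum of the classes of the non-projective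
indecomposable summands (with multiplicity) in a Krull-Schmidt decomposition of `X`. -/
def modClass (X : ModuleCat.{u} A) : KProj A :=
  if h : Nonempty (Decomposition X) then
    ∑ i : Fin h.some.n,
      if hi : Projective (h.some.Y i) then 0
      else basisClass ⟨h.some.Y i, h.some.fg i, h.some.indec i, hi⟩
  else 0

variable (A) in
/-- The endomorphism `L` of the group, `L [X] = [Ω X]`. -/
def syzygyMap : KProj A →ₗ[ℤ] KProj A :=
  Finsupp.linearCombination ℤ fun q => modClass (syzygy (_root_.Quotient.out q).1)

/-- The subgroup `⟨X⟩` generated by the classes of the indecomposable non-projective direct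
summands of `X`. -/
def summandGroup (X : ModuleCat.{u} A) : Submodule ℤ (KProj A) :=
  Submodule.span ℤ {x | ∃ Y : IndecNonProj A,
    (∃ W : ModuleCat.{u} A, Nonempty (X ≅ Y.1 ⊞ W)) ∧ x = basisClass Y}

/-- The rank of `L^k ⟨X⟩`. -/
def syzygyRank (k : ℕ) (X : ModuleCat.{u} A) : ℕ :=
  Module.finrank ℤ ((summandGroup X).map (syzygyMap A ^ k))

/-- The Igusa-Todorov function: the least `n` such that the ranks of `L^k ⟨X⟩` and
`L^(k+1) ⟨X⟩` agree for all `k ≥ n`. -/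
def Phi (X : ModuleCat.{u} A) : ℕ :=
  sInf {n : ℕ | ∀ k, n ≤ k → syzygyRank k X = syzygyRank (k + 1) X}

/-! ### GLIT classes and special GLIT algebras -/

/-- `add 𝒟`: direct summands of finite direct sums of modules in `𝒟`. -/
def addClosure (D : ObjectProperty (ModuleCat.{u} A)) : ObjectProperty (ModuleCat.{u} A) :=
  fun X => ∃ (n : ℕ) (Y : Fin n → ModuleCat.{u} A) (W : ModuleCat.{u} A),
    (∀ i, D (Y i)) ∧ Nonempty ((⨁ Y) ≅ X ⊞ W)

/-- `𝒞` is an `(n, t, V, 𝒟)`-GLIT class. -/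
structure IsGLITClassWith (C : ObjectProperty (ModuleCat.{u} A)) (n t : ℕ) (V : ModuleCat.{u} A)
    (D : ObjectProperty (ModuleCat.{u} A)) : Prop where
  one_le : 1 ≤ t
  D_fg : ∀ X, D X → fgMod A X
  D_add : addClosure D = D
  D_syzygy : ∀ X, D X → D (syzygy^[t] X)
  D_phiDim : ∃ d : ℕ, ∀ X, D X → Phi X ≤ d
  V_fg : fgMod A V
  exact_seq : ∀ X, C X → ∃ V₁ D₁ V₀ D₀ : ModuleCat.{u} A,
    addClosure (fun Y => Y = V) V₁ ∧ D D₁ ∧ addClosure (fun Y => Y = V) V₀ ∧ D D₀ ∧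
    ∃ (i : V₁ ⊞ D₁ ⟶ V₀ ⊞ D₀) (p : V₀ ⊞ D₀ ⟶ syzygy^[n] X) (w : i ≫ p = 0),
      (ShortComplex.mk i p w).ShortExact

/-- `𝒞` is an `n`-GLIT class. -/
def IsGLITClass (C : ObjectProperty (ModuleCat.{u} A)) (n : ℕ) : Prop :=
  ∃ (t : ℕ) (V : ModuleCat.{u} A) (D : ObjectProperty (ModuleCat.{u} A)),
    IsGLITClassWith C n t V D

/-- `𝒞` is a special GLIT class: `𝒫^{<∞}(𝒞)` is a `0`-GLIT class. -/
def IsSpecialGLITClass (C : ObjectProperty (ModuleCat.{u} A)) : Prop :=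
  IsGLITClass (finPD C) 0

variable (A) in
/-- An Artin algebra `A` is special GLIT if `mod A` is a special GLIT class. -/
def IsSpecialGLIT : Prop := IsSpecialGLITClass (fgMod A)

end Modules

end GLIT

end

/-! For an artinian ring, being special GLIT is equivalent to having finite finitistic dimension
(`isSpecialGLIT_iff_finDim_ne_top`). Both assertions therefore reduce to comparing finitistic
dimensions.

If the finitistic dimension is a finite `n`, the modules of finite projective dimension themselves
serve as `𝒟`, with `V = 0`: their `Φ` is at most `n`. The converse is an Igusa–Todorov argument. Let
`0 → V₁ ⊕ D₁ → V₀ ⊕ D₀ → X → 0` be given with `pd X` finite. A high power of `L` identifies the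
classes of the first two terms. Their difference lies in `⟨V⟩` plus the span of `𝒟`, and there the
bound on `Φ` gives one exponent that kills everything killed by some power of `L`
(`exists_uniform_nilpotency`). So after a number of syzygies independent of `X` the two terms are
stably isomorphic, and adding projectives yields `0 → E → E ⊕ P → Z → 0`. Fitting's lemma splits `E`
into a part on which the component `E → E` is nilpotent and one on which it is invertible. The long
exact Ext sequence shows that the nilpotent part has finite projective dimension and bounds `pd Z`
up to one (`exists_summand_controlling`). As a summand of `E`, it has its class in a subgroup of the
same kind, so uniform nilpotency, used a second time, bounds its projective dimension.

On the Morita side, put `R = T × U` and `I = N ⊕ M`. Since `M ⊗ N = 0 = N ⊗ M`, the Morita ring `Λ`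
is the trivial extension of `R` by `I`, and `I ⊗_R I = 0` (`isTrivialExtension_moritaRing`). This
makes `I` projective over `Λ` and gives an exact sequence `0 → I ⊗_R Z → Λ ⊗_R Z → Z → 0`, whence
`pd_Λ Z ≤ pd_R Z + 1`. As `Λ` is projective over `R`, restriction does not raise projective
dimension. Hence `fin.dim R ≤ fin.dim Λ ≤ fin.dim R + 1`, and `fin.dim R` is the maximum over the
two factors. -/

namespace GLIT

/-! ### Exchange of direct summands in an abelian category -/

section Exchange

universe v w

variable {C : Type w} [Category.{v} C] [Abelian C]

theorem exists_iso_biprod_of_retract {Y R : C} (a : Y ⟶ R) (b : R ⟶ Y) (h : a ≫ b = 𝟙 Y) :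
    ∃ (R' : C) (e : R ≅ Y ⊞ R'), e.hom ≫ biprod.fst = b := by
  let S : ShortComplex C := ShortComplex.mk a (cokernel.π a) (cokernel.condition a)
  have hS : S.Exact := ShortComplex.exact_cokernel a
  let s : S.Splitting := ShortComplex.Splitting.ofExactOfRetraction S hS b h
    (inferInstanceAs (Epi (cokernel.π a)))
  exact ⟨cokernel a, s.isoBinaryBiproduct, by simpa [S] using
    show s.r = b from rfl⟩

/-- In any decomposition of the identity into two summands, one of them is invertible. -/
def LocalEnd (Y : C) : Prop := ∀ f g : Y ⟶ Y, f + g = 𝟙 Y → IsIso f ∨ IsIso g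

theorem nonempty_iso_of_retract_indecomposable {Y Z : C} (hY : ¬ IsZero Y) (hZ : Indecomposable Z)
    (a : Y ⟶ Z) (b : Z ⟶ Y) [IsIso (a ≫ b)] : IsIso a := by
  obtain ⟨R', e, he⟩ := exists_iso_biprod_of_retract a (b ≫ inv (a ≫ b))
    (by rw [← Category.assoc, IsIso.hom_inv_id])
  have h0 : IsZero R' := (hZ.2 _ _ e).resolve_left hY
  have : IsIso (b ≫ inv (a ≫ b)) := by
    rw [← he]
    have : IsIso (biprod.fst : Y ⊞ R' ⟶ Y) :=
      ⟨biprod.inl, by ext <;> simp [h0.eq_of_src biprod.inr 0, h0.eq_of_tgt biprod.snd 0], by simp⟩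
    infer_instance
  have : IsIso b := IsIso.of_isIso_comp_right b (inv (a ≫ b))
  exact IsIso.of_isIso_comp_right a b

/-- The identity of `Y` is the sum of its passages through `Z` and through `R`, and locality makes
one of them invertible. In the first case `Y ≅ Z` can be cancelled; in the second `Y` splits off
`R`, and after trading that copy of `Y` for `Z` it can be cancelled. -/
theorem exchange {Y W Z R : C} (e : Y ⊞ W ≅ Z ⊞ R) (hY : LocalEnd Y) (hY0 : ¬ IsZero Y)
    (hZ : Indecomposable Z) :
    (Nonempty (Y ≅ Z) ∧ Nonempty (W ≅ R)) ∨
      ∃ R' : C, Nonempty (R ≅ Y ⊞ R') ∧ Nonempty (W ≅ Z ⊞ R') := by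
  have hid : (biprod.inl ≫ e.hom ≫ biprod.fst) ≫ (biprod.inl ≫ e.inv ≫ biprod.fst) +
      (biprod.inl ≫ e.hom ≫ biprod.snd) ≫ (biprod.inr ≫ e.inv ≫ biprod.fst) = 𝟙 Y := by
    have : biprod.inl ≫ e.hom ≫ (biprod.fst ≫ biprod.inl + biprod.snd ≫ biprod.inr) ≫
        e.inv ≫ biprod.fst = 𝟙 Y := by
      rw [biprod.total]; simp
    rw [← this]
    simp only [Preadditive.add_comp, Preadditive.comp_add, Category.assoc]
  rcases hY _ _ hid with h | h
  · left
    have := nonempty_iso_of_retract_indecomposable hY0 hZ (biprod.inl ≫ e.hom ≫ biprod.fst)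
      (biprod.inl ≫ e.inv ≫ biprod.fst)
    exact ⟨⟨asIso (biprod.inl ≫ e.hom ≫ biprod.fst)⟩, ⟨Biprod.isoElim e⟩⟩
  · right
    set a := biprod.inl ≫ e.hom ≫ biprod.snd with ha
    set b := biprod.inr ≫ e.inv ≫ biprod.fst with hb
    obtain ⟨R', i, hi⟩ := exists_iso_biprod_of_retract a (b ≫ inv (a ≫ b))
      (by rw [← Category.assoc, IsIso.hom_inv_id])
    refine ⟨R', ⟨i⟩, ?_⟩
    -- Rearranges `Z ⊞ R` so that the copy of `Y` inside `R` comes first; the component `Y → Y` of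
    -- `e ≪≫ sw` is then the identity, and `Biprod.isoElim` applies.
    let sw : Z ⊞ R ≅ Y ⊞ (Z ⊞ R') :=
      { hom := biprod.lift (biprod.snd ≫ i.hom ≫ biprod.fst)
          (biprod.lift biprod.fst (biprod.snd ≫ i.hom ≫ biprod.snd))
        inv := biprod.lift (biprod.snd ≫ biprod.fst)
          (biprod.lift biprod.fst (biprod.snd ≫ biprod.snd) ≫ i.inv)
        hom_inv_id := by
          apply biprod.hom_ext
          · simp
          · rw [Category.assoc, biprod.lift_snd, ← Category.assoc]
            have h2 : biprod.lift ((biprod.snd : Z ⊞ R ⟶ R) ≫ i.hom ≫ biprod.fst)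
                (biprod.lift biprod.fst (biprod.snd ≫ i.hom ≫ biprod.snd)) ≫
                biprod.lift biprod.fst (biprod.snd ≫ biprod.snd) = biprod.snd ≫ i.hom := by
              ext <;> simp
            rw [h2]; simp
        inv_hom_id := by
          apply biprod.hom_ext
          · simp
          · apply biprod.hom_ext <;> simp }
    have : IsIso (biprod.inl ≫ (e ≪≫ sw).hom ≫ biprod.fst) := by
      have : biprod.inl ≫ (e ≪≫ sw).hom ≫ biprod.fst = 𝟙 Y := by
        simp only [Iso.trans_hom, sw, Category.assoc, biprod.lift_fst]
        rw [hi]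
        rw [← IsIso.hom_inv_id (a ≫ b)]
        simp only [ha, Category.assoc]
      rw [this]; infer_instance
    exact ⟨Biprod.isoElim (e ≪≫ sw)⟩

end Exchange

/-! ### Finitely generated modules, length and Fitting's lemma -/

section Length

variable {A : Type u} [Ring A]

theorem fgMod_of_iso {X Y : ModuleCat.{u} A} (e : X ≅ Y) (h : fgMod A X) : fgMod A Y :=
  have : Module.Finite A X := h
  Module.Finite.equiv e.toLinearEquiv

theorem fgMod_prod {X Y : ModuleCat.{u} A} (hX : fgMod A X) (hY : fgMod A Y) :
    fgMod A (X ⊞ Y) := by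
  have : Module.Finite A X := hX
  have : Module.Finite A Y := hY
  exact fgMod_of_iso (ModuleCat.biprodIsoProd X Y).symm (inferInstanceAs (Module.Finite A (X × Y)))

theorem fgMod_of_epi {X Y : ModuleCat.{u} A} (f : X ⟶ Y) [Epi f] (h : fgMod A X) : fgMod A Y :=
  have : Module.Finite A X := h
  Module.Finite.of_surjective f.hom ((ModuleCat.epi_iff_surjective f).1 inferInstance)

theorem fgMod_of_mono [IsNoetherianRing A] {X Y : ModuleCat.{u} A} (f : X ⟶ Y) [Mono f]
    (h : fgMod A Y) : fgMod A X := by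
  have : Module.Finite A Y := h
  have : IsNoetherian A Y := isNoetherian_of_isNoetherianRing_of_finite A Y
  exact Module.Finite.of_injective f.hom ((ModuleCat.mono_iff_injective f).1 inferInstance)

theorem fgMod_fst {X Y : ModuleCat.{u} A} (h : fgMod A (X ⊞ Y)) : fgMod A X :=
  fgMod_of_epi (biprod.fst : X ⊞ Y ⟶ X) h

theorem fgMod_snd {X Y : ModuleCat.{u} A} (h : fgMod A (X ⊞ Y)) : fgMod A Y :=
  fgMod_of_epi (biprod.snd : X ⊞ Y ⟶ Y) h

theorem fgMod_of_retract {X Y : ModuleCat.{u} A} (r : Retract X Y) (h : fgMod A Y) : fgMod A X :=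
  fgMod_of_epi r.r h

theorem length_biprod (X Y : ModuleCat.{u} A) :
    Module.length A (X ⊞ Y : ModuleCat.{u} A) = Module.length A X + Module.length A Y := by
  rw [(ModuleCat.biprodIsoProd X Y).toLinearEquiv.length_eq]
  exact Module.length_prod A X Y

variable [IsArtinianRing A]

theorem length_ne_top {X : ModuleCat.{u} A} (h : fgMod A X) : Module.length A X ≠ ⊤ := by
  have : Module.Finite A X := h
  have : IsNoetherian A X := isNoetherian_of_isNoetherianRing_of_finite A X
  have : IsArtinian A X := isArtinian_of_fg_of_artinian' 
  rw [Module.length_ne_top_iff, isFiniteLength_iff_isNoetherian_isArtinian]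
  exact ⟨‹_›, ‹_›⟩

/-- By Fitting's lemma an endomorphism of an indecomposable module of finite length is invertible or
nilpotent, and `1 - f` is invertible for nilpotent `f`. -/
theorem localEnd_of_indecomposable {X : ModuleCat.{u} A} (h : fgMod A X) (hX : Indecomposable X) :
    LocalEnd X := by
  have : Module.Finite A X := h
  have : IsNoetherian A X := isNoetherian_of_isNoetherianRing_of_finite A X
  have : IsArtinian A X := isArtinian_of_fg_of_artinian'
  have key : ∀ f : X ⟶ X, IsIso f ∨ ∃ n : ℕ, f.hom ^ n = 0 := by
    intro f
    obtain ⟨n, hn⟩ := Filter.eventually_atTop.mp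
      (LinearMap.eventually_isCompl_ker_pow_range_pow f.hom)
    -- A positive exponent is needed: the kernel of `f` must lie in that of the power.
    have hc := hn (n + 1) (Nat.le_succ n)
    let e := (Submodule.prodEquivOfIsCompl _ _ hc)
    have e' : X ≅ ModuleCat.of A (LinearMap.ker (f.hom ^ (n + 1))) ⊞
        ModuleCat.of A (LinearMap.range (f.hom ^ (n + 1))) :=
      e.toModuleIso.symm ≪≫ (ModuleCat.biprodIsoProd (ModuleCat.of A _) (ModuleCat.of A _)).symm
    rcases hX.2 _ _ e' with h | h
    · left
      have hs := ModuleCat.subsingleton_of_isZero h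
      have hk : LinearMap.ker (f.hom ^ (n + 1)) = ⊥ := Submodule.subsingleton_iff_eq_bot.1 hs
      have hk' : LinearMap.ker f.hom = ⊥ := by
        rw [eq_bot_iff, ← hk]
        intro x hx
        simp only [LinearMap.mem_ker] at hx ⊢
        rw [pow_succ, Module.End.mul_apply, hx, map_zero]
      have hinj : Function.Injective f.hom := LinearMap.ker_eq_bot.1 hk'
      have hb : Function.Bijective f.hom :=
        ⟨hinj, IsArtinian.surjective_of_injective_endomorphism f.hom hinj⟩
      exact (ConcreteCategory.isIso_iff_bijective f).2 hb
    · right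
      have hs := ModuleCat.subsingleton_of_isZero h
      exact ⟨n + 1, LinearMap.range_eq_bot.1 (Submodule.subsingleton_iff_eq_bot.1 hs)⟩
  intro f g hfg
  rcases key f with h | ⟨n, hn⟩
  · exact Or.inl h
  · right
    have hg : g.hom = 1 - f.hom := by
      have := congrArg ModuleCat.Hom.hom hfg
      rw [ModuleCat.hom_add, ModuleCat.hom_id] at this
      rw [eq_sub_iff_add_eq, add_comm]; exact this
    have hu : IsUnit g.hom := by
      rw [hg]; exact IsNilpotent.isUnit_one_sub ⟨n, hn⟩
    exact (ConcreteCategory.isIso_iff_bijective g).2 ((Module.End.isUnit_iff _).1 hu)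

end Length

end GLIT

namespace GLIT

/-! ### Krull–Schmidt and the class of a module -/

section KrullSchmidt

variable {A : Type u} [Ring A]

/-- The direct sum of a list of modules. -/
noncomputable def sumList : List (ModuleCat.{u} A) → ModuleCat.{u} A
  | [] => ModuleCat.of A PUnit
  | Y :: l => Y ⊞ sumList l

/-- All members of the list are finitely generated and indecomposable. -/
def IndecList (l : List (ModuleCat.{u} A)) : Prop := ∀ Y ∈ l, fgMod A Y ∧ Indecomposable Y

open Classical in
/-- The class of an indecomposable module, zero if it is projective. -/
noncomputable def indecClass (Y : ModuleCat.{u} A) : KProj A :=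
  if h : fgMod A Y ∧ Indecomposable Y ∧ ¬ Projective Y then basisClass ⟨Y, h⟩ else 0

/-- The sum of the classes of the members of a list. -/
noncomputable def classList (l : List (ModuleCat.{u} A)) : KProj A := (l.map indecClass).sum

theorem isZero_sumList_nil : IsZero (sumList ([] : List (ModuleCat.{u} A))) :=
  ModuleCat.isZero_of_subsingleton (ModuleCat.of A PUnit)

noncomputable def biprodZeroIso {X Z : ModuleCat.{u} A} (h : IsZero Z) : X ⊞ Z ≅ X where
  hom := biprod.fst
  inv := biprod.inl
  hom_inv_id := by
    apply biprod.hom_ext' <;> simp [h.eq_of_src biprod.inr 0]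

noncomputable def zeroBiprodIso {X Z : ModuleCat.{u} A} (h : IsZero Z) : Z ⊞ X ≅ X :=
  biprod.braiding Z X ≪≫ biprodZeroIso h

noncomputable def sumListAppend :
    ∀ l l' : List (ModuleCat.{u} A), sumList (l ++ l') ≅ sumList l ⊞ sumList l'
  | [], _ => (zeroBiprodIso isZero_sumList_nil).symm
  | Y :: l, l' => biprod.mapIso (Iso.refl Y) (sumListAppend l l') ≪≫ (biprod.associator _ _ _).symm

theorem classList_append (l l' : List (ModuleCat.{u} A)) :
    classList (l ++ l') = classList l + classList l' := by
  simp [classList]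

theorem indecomposable_of_iso {X Y : ModuleCat.{u} A} (e : X ≅ Y) (h : Indecomposable X) :
    Indecomposable Y :=
  ⟨fun h0 => h.1 (h0.of_iso e), fun Z W f => h.2 Z W (e ≪≫ f)⟩

theorem projective_iff_of_iso {X Y : ModuleCat.{u} A} (e : X ≅ Y) :
    Projective X ↔ Projective Y :=
  ⟨fun h => Projective.of_iso e h, fun h => Projective.of_iso e.symm h⟩

theorem indecClass_congr {X Y : ModuleCat.{u} A} (e : X ≅ Y) : indecClass X = indecClass Y := by
  unfold indecClass
  by_cases h : fgMod A X ∧ Indecomposable X ∧ ¬ Projective X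
  · have h' : fgMod A Y ∧ Indecomposable Y ∧ ¬ Projective Y :=
      ⟨fgMod_of_iso e h.1, indecomposable_of_iso e h.2.1,
        fun hp => h.2.2 ((projective_iff_of_iso e).2 hp)⟩
    rw [dif_pos h, dif_pos h']
    unfold basisClass
    congr 1
    exact Quotient.sound ⟨e⟩
  · have h' : ¬ (fgMod A Y ∧ Indecomposable Y ∧ ¬ Projective Y) := fun h' => h
      ⟨fgMod_of_iso e.symm h'.1, indecomposable_of_iso e.symm h'.2.1,
        fun hp => h'.2.2 ((projective_iff_of_iso e).1 hp)⟩
    rw [dif_neg h, dif_neg h']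

theorem indecClass_of_projective {X : ModuleCat.{u} A} (h : Projective X) : indecClass X = 0 :=
  dif_neg fun h' => h'.2.2 h

theorem indecClass_eq (Y : IndecNonProj A) : indecClass Y.1 = basisClass Y :=
  dif_pos Y.2

theorem indecClass_nonneg (X : ModuleCat.{u} A) : 0 ≤ indecClass X := by
  unfold indecClass
  split_ifs
  · exact Finsupp.single_nonneg.2 zero_le_one
  · exact le_rfl

theorem classList_nonneg (l : List (ModuleCat.{u} A)) : 0 ≤ classList l := by
  refine List.sum_nonneg fun x hx => ?_
  obtain ⟨Y, _, rfl⟩ := List.mem_map.1 hx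
  exact indecClass_nonneg Y

/-- A finite biproduct is the sum of the list of its members. -/
noncomputable def biproductIsoSumList :
    ∀ {n : ℕ} (Y : Fin n → ModuleCat.{u} A), (⨁ Y) ≅ sumList (List.ofFn Y)
  | 0, Y => by
      rw [List.ofFn_zero]
      refine IsZero.iso ?_ isZero_sumList_nil
      have : IsZero (ModuleCat.of A (∀ j, Y j)) := ModuleCat.isZero_of_subsingleton _
      exact this.of_iso (ModuleCat.biproductIsoPi Y)
  | n + 1, Y => by
      rw [List.ofFn_succ]
      exact ModuleCat.biproductIsoPi Y ≪≫
        (Fin.consLinearEquiv A (fun i => (Y i : Type u))).symm.toModuleIso ≪≫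
        (ModuleCat.biprodIsoProd (Y 0) (ModuleCat.of A (∀ i : Fin n, Y i.succ))).symm ≪≫
        biprod.mapIso (Iso.refl _) ((ModuleCat.biproductIsoPi fun i : Fin n => Y i.succ).symm ≪≫
          biproductIsoSumList fun i => Y i.succ)

variable [IsArtinianRing A]

theorem exists_indecList (X : ModuleCat.{u} A) (hX : fgMod A X) :
    ∃ l : List (ModuleCat.{u} A), IndecList l ∧ Nonempty (X ≅ sumList l) := by
  obtain ⟨n, hn⟩ : ∃ n : ℕ, Module.length A X = n := by
    exact ⟨_, (ENat.natCast_toNat (length_ne_top hX)).symm⟩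
  induction n using Nat.strong_induction_on generalizing X with
  | _ n ih =>
    by_cases h0 : IsZero X
    · exact ⟨[], by simp [IndecList], ⟨h0.iso isZero_sumList_nil⟩⟩
    by_cases hi : Indecomposable X
    · exact ⟨[X], by simpa [IndecList] using ⟨hX, hi⟩, ⟨(biprodZeroIso isZero_sumList_nil).symm⟩⟩
    · have : ∃ Y Z, ∃ _ : X ≅ Y ⊞ Z, ¬ IsZero Y ∧ ¬ IsZero Z := by
        by_contra hne
        push Not at hne
        exact hi ⟨h0, fun Y Z e => or_iff_not_imp_left.2 (hne Y Z e)⟩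
      obtain ⟨Y, Z, e, hY, hZ⟩ := this
      have hYZ := fgMod_of_iso e hX
      have hl : Module.length A Y + Module.length A Z = n := by
        rw [← length_biprod, ← e.toLinearEquiv.length_eq, hn]
      have hY0 : Module.length A Y ≠ 0 := fun h => hY
        (by have := Module.length_eq_zero_iff.1 h; exact ModuleCat.isZero_of_subsingleton Y)
      have hZ0 : Module.length A Z ≠ 0 := fun h => hZ
        (by have := Module.length_eq_zero_iff.1 h; exact ModuleCat.isZero_of_subsingleton Z)
      obtain ⟨a, ha⟩ : ∃ n : ℕ, Module.length A Y = n :=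
        ⟨_, (ENat.natCast_toNat (length_ne_top (fgMod_fst hYZ))).symm⟩
      obtain ⟨b, hb⟩ : ∃ n : ℕ, Module.length A Z = n :=
        ⟨_, (ENat.natCast_toNat (length_ne_top (fgMod_snd hYZ))).symm⟩
      rw [ha, hb] at hl
      rw [ha] at hY0
      rw [hb] at hZ0
      norm_cast at hl hY0 hZ0
      obtain ⟨l, hl1, ⟨e1⟩⟩ := ih a (by omega) Y (fgMod_fst hYZ) ha
      obtain ⟨l', hl2, ⟨e2⟩⟩ := ih b (by omega) Z (fgMod_snd hYZ) hb
      refine ⟨l ++ l', ?_, ⟨e ≪≫ biprod.mapIso e1 e2 ≪≫ (sumListAppend l l').symm⟩⟩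
      intro W hW
      rcases List.mem_append.1 hW with h | h
      exacts [hl1 W h, hl2 W h]

/-- The exchange lemma either matches `Y` with the head of the list or moves it into the tail, where
induction removes it. -/
theorem exists_remove_summand {Y : ModuleCat.{u} A} (hY : fgMod A Y) (hYi : Indecomposable Y)
    (l : List (ModuleCat.{u} A)) (hl : IndecList l) (W : ModuleCat.{u} A)
    (e : Y ⊞ W ≅ sumList l) :
    ∃ l' : List (ModuleCat.{u} A), IndecList l' ∧ Nonempty (W ≅ sumList l') ∧
      classList l = indecClass Y + classList l' := by
  induction l generalizing W with
  | nil =>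
    refine absurd ?_ hYi.1
    have h0 : IsZero (Y ⊞ W) := isZero_sumList_nil.of_iso e
    exact ((biprod_isZero_iff Y W).1 h0).1
  | cons Z l ih =>
    have hl' : IndecList l := fun V hV => hl V (List.mem_cons_of_mem _ hV)
    have hZ := hl Z List.mem_cons_self
    rcases exchange e (localEnd_of_indecomposable hY hYi) hYi.1 hZ.2 with
      ⟨⟨e1⟩, ⟨e2⟩⟩ | ⟨R', ⟨e1⟩, ⟨e2⟩⟩
    · exact ⟨l, hl', ⟨e2⟩, by simp [classList, indecClass_congr e1]⟩
    · obtain ⟨l', h1, ⟨h2⟩, h3⟩ := ih hl' R' e1.symm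
      refine ⟨Z :: l', ?_, ⟨e2 ≪≫ biprod.mapIso (Iso.refl Z) h2⟩, ?_⟩
      · intro V hV
        rcases List.mem_cons.1 hV with rfl | h
        exacts [hZ, h1 V h]
      · simp only [classList, List.map_cons, List.sum_cons] at h3 ⊢
        rw [h3]; abel

theorem classList_eq_of_iso (l l' : List (ModuleCat.{u} A)) (hl : IndecList l) (hl' : IndecList l')
    (e : sumList l ≅ sumList l') : classList l = classList l' := by
  induction l generalizing l' with
  | nil =>
    cases l' with
    | nil => rfl
    | cons Z l' =>
      have h0 : IsZero (Z ⊞ sumList l') := isZero_sumList_nil.of_iso e.symm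
      exact absurd ((biprod_isZero_iff _ _).1 h0).1 (hl' Z List.mem_cons_self).2.1
  | cons Y l ih =>
    have hY := hl Y List.mem_cons_self
    obtain ⟨l'', h1, ⟨h2⟩, h3⟩ := exists_remove_summand hY.1 hY.2 l' hl' (sumList l) e
    rw [h3, ← ih l'' (fun V hV => hl V (List.mem_cons_of_mem _ hV)) h1 h2]
    simp [classList]

/-- `modClass` is defined through a chosen decomposition; uniqueness in Krull–Schmidt lets any
decomposition compute it. -/
theorem modClass_eq_classList {X : ModuleCat.{u} A} {l : List (ModuleCat.{u} A)}
    (hl : IndecList l) (e : X ≅ sumList l) : modClass X = classList l := by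
  have hn : Nonempty (Decomposition X) := by
    have hY : List.ofFn (fun i : Fin l.length => l.get i) = l := List.ofFn_get l
    refine ⟨⟨l.length, fun i => l.get i, fun i => (hl _ (List.get_mem l i)).1,
      fun i => (hl _ (List.get_mem l i)).2, e ≪≫ ?_⟩⟩
    exact eqToIso (by rw [hY]) ≪≫ (biproductIsoSumList fun i : Fin l.length => l.get i).symm
  rw [modClass, dif_pos hn]
  set d := hn.some
  have hd : IndecList (List.ofFn d.Y) := by
    intro Z hZ
    obtain ⟨i, rfl⟩ := (List.mem_ofFn' _ _).1 hZ
    exact ⟨d.fg i, d.indec i⟩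
  rw [← classList_eq_of_iso _ _ hd hl ((biproductIsoSumList d.Y).symm ≪≫ d.iso.symm ≪≫ e)]
  rw [classList, List.map_ofFn, List.sum_ofFn]
  refine Finset.sum_congr rfl fun i _ => ?_
  simp only [Function.comp]
  by_cases h : Projective (d.Y i)
  · exact (dif_pos h).trans (indecClass_of_projective h).symm
  · exact (dif_neg h).trans (indecClass_eq ⟨d.Y i, d.fg i, d.indec i, h⟩).symm

theorem modClass_congr {X Y : ModuleCat.{u} A} (hX : fgMod A X) (e : X ≅ Y) :
    modClass X = modClass Y := by
  obtain ⟨l, hl, ⟨f⟩⟩ := exists_indecList X hX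
  rw [modClass_eq_classList hl f, modClass_eq_classList hl (e.symm ≪≫ f)]

theorem modClass_biprod {X Y : ModuleCat.{u} A} (hX : fgMod A X) (hY : fgMod A Y) :
    modClass (X ⊞ Y) = modClass X + modClass Y := by
  obtain ⟨l, hl, ⟨f⟩⟩ := exists_indecList X hX
  obtain ⟨l', hl', ⟨f'⟩⟩ := exists_indecList Y hY
  rw [modClass_eq_classList hl f, modClass_eq_classList hl' f', ← classList_append]
  refine modClass_eq_classList ?_ (biprod.mapIso f f' ≪≫ (sumListAppend l l').symm)
  intro W hW
  rcases List.mem_append.1 hW with h | h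
  exacts [hl W h, hl' W h]

theorem modClass_of_indecomposable {X : ModuleCat.{u} A} (hX : fgMod A X)
    (hi : Indecomposable X) : modClass X = indecClass X := by
  rw [modClass_eq_classList (l := [X]) (by simpa [IndecList] using ⟨hX, hi⟩)
    (biprodZeroIso isZero_sumList_nil).symm]
  simp [classList]

theorem modClass_basis (Y : IndecNonProj A) : modClass Y.1 = basisClass Y := by
  rw [modClass_of_indecomposable Y.2.1 Y.2.2.1, indecClass_eq]

theorem modClass_nonneg {X : ModuleCat.{u} A} (hX : fgMod A X) : 0 ≤ modClass X := by
  obtain ⟨l, hl, ⟨f⟩⟩ := exists_indecList X hX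
  rw [modClass_eq_classList hl f]
  exact classList_nonneg l

end KrullSchmidt

end GLIT

namespace GLIT

/-! ### Short exact sequences and Schanuel's lemma -/

section ShortExactSequences

variable {A : Type u} [Ring A]

/-- There is a short exact sequence `0 → X → Y → Z → 0`. -/
def SES (X Y Z : ModuleCat.{u} A) : Prop :=
  ∃ (f : X →ₗ[A] Y) (g : Y →ₗ[A] Z),
    Function.Injective f ∧ Function.Surjective g ∧ Function.Exact f g

theorem SES.exists_shortExact {X Y Z : ModuleCat.{u} A} (h : SES X Y Z) :
    ∃ (i : X ⟶ Y) (p : Y ⟶ Z) (w : i ≫ p = 0), (ShortComplex.mk i p w).ShortExact := by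
  obtain ⟨f, g, hf, hg, hfg⟩ := h
  exact ⟨ModuleCat.ofHom f, ModuleCat.ofHom g, ModuleCat.hom_ext hfg.linearMap_comp_eq_zero,
    ModuleCat.shortComplex_shortExact _ hfg hf hg⟩

theorem ses_of_shortExact {X Y Z : ModuleCat.{u} A} {i : X ⟶ Y} {p : Y ⟶ Z} {w : i ≫ p = 0}
    (h : (ShortComplex.mk i p w).ShortExact) : SES X Y Z :=
  ⟨i.hom, p.hom, h.moduleCat_injective_f, h.moduleCat_surjective_g,
    (ShortComplex.ShortExact.moduleCat_exact_iff_function_exact _).1 h.exact⟩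

theorem SES.congr {X Y Z X' Y' Z' : ModuleCat.{u} A} (h : SES X Y Z) (eX : X ≅ X') (eY : Y ≅ Y')
    (eZ : Z ≅ Z') : SES X' Y' Z' := by
  obtain ⟨f, g, hf, hg, hfg⟩ := h
  refine ⟨eY.toLinearEquiv.toLinearMap ∘ₗ f ∘ₗ eX.toLinearEquiv.symm.toLinearMap,
    eZ.toLinearEquiv.toLinearMap ∘ₗ g ∘ₗ eY.toLinearEquiv.symm.toLinearMap, ?_, ?_, ?_⟩
  · exact eY.toLinearEquiv.injective.comp (hf.comp eX.toLinearEquiv.symm.injective)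
  · exact eZ.toLinearEquiv.surjective.comp (hg.comp eY.toLinearEquiv.symm.surjective)
  · intro y
    simp only [LinearMap.comp_apply, LinearEquiv.coe_coe, LinearEquiv.map_eq_zero_iff, hfg _,
      Set.mem_range]
    constructor
    · rintro ⟨x, hx⟩
      exact ⟨eX.toLinearEquiv x, by simp [hx]⟩
    · rintro ⟨x, rfl⟩
      exact ⟨eX.toLinearEquiv.symm x, by simp⟩

theorem SES.prod {X Y Z X' Y' Z' : ModuleCat.{u} A} (h : SES X Y Z) (h' : SES X' Y' Z') :
    SES (X ⊞ X') (Y ⊞ Y') (Z ⊞ Z') := by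
  obtain ⟨f, g, hf, hg, hfg⟩ := h
  obtain ⟨f', g', hf', hg', hfg'⟩ := h'
  have : SES (ModuleCat.of A (X × X')) (ModuleCat.of A (Y × Y')) (ModuleCat.of A (Z × Z')) :=
    ⟨f.prodMap f', g.prodMap g', hf.prodMap hf', hg.prodMap hg', by
      rintro ⟨y, y'⟩
      have h1 := hfg y
      have h2 := hfg' y'
      simp only [LinearMap.prodMap_apply, Prod.mk_eq_zero, h1, h2, Set.mem_range, Prod.exists,
        Prod.mk.injEq]
      constructor
      · rintro ⟨⟨x, hx⟩, ⟨x', hx'⟩⟩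
        exact ⟨x, x', hx, hx'⟩
      · rintro ⟨x, x', hx, hx'⟩
        exact ⟨⟨x, hx⟩, ⟨x', hx'⟩⟩⟩
  exact this.congr (ModuleCat.biprodIsoProd _ _).symm (ModuleCat.biprodIsoProd _ _).symm
    (ModuleCat.biprodIsoProd _ _).symm

theorem SES.zero_left (X : ModuleCat.{u} A) : SES (ModuleCat.of A PUnit) X X :=
  ⟨0, LinearMap.id, fun _ _ _ => Subsingleton.elim _ _, Function.surjective_id, fun x => by
    simp [eq_comm]⟩

theorem SES.iso_of_projective {X Y Z : ModuleCat.{u} A} (h : SES X Y Z) [Projective Z] :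
    Nonempty (Y ≅ X ⊞ Z) := by
  obtain ⟨i, p, w, hS⟩ := h.exists_shortExact
  have : Projective (ShortComplex.mk i p w).X₃ := ‹_›
  exact ⟨hS.splittingOfProjective.isoBinaryBiproduct⟩

theorem projective_iff (X : ModuleCat.{u} A) : Projective X ↔ Module.Projective A X :=
  (IsProjective.iff_projective X).symm

theorem projective_biprod_iff {X Y : ModuleCat.{u} A} :
    Projective (X ⊞ Y) ↔ Projective X ∧ Projective Y := by
  constructor
  · intro h
    exact ⟨Retract.projective (Y := X ⊞ Y) ⟨biprod.inl, biprod.fst, by simp⟩,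
      Retract.projective (Y := X ⊞ Y) ⟨biprod.inr, biprod.snd, by simp⟩⟩
  · rintro ⟨h1, h2⟩
    infer_instance

theorem projective_of_isZero {X : ModuleCat.{u} A} (h : IsZero X) : Projective X :=
  Projective.of_iso (isZero_zero _ |>.iso h) inferInstance

/-- `K` is the kernel of a surjection from a finitely generated projective module onto `X`. -/
def IsSyz (K X : ModuleCat.{u} A) : Prop :=
  ∃ P : ModuleCat.{u} A, fgMod A P ∧ Projective P ∧ SES K P X

theorem IsSyz.congr {K X K' X' : ModuleCat.{u} A} (h : IsSyz K X) (e : K ≅ K') (f : X ≅ X') :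
    IsSyz K' X' := by
  obtain ⟨P, h1, h2, h3⟩ := h
  exact ⟨P, h1, h2, h3.congr e (Iso.refl P) f⟩

theorem IsSyz.prod {K X K' X' : ModuleCat.{u} A} (h : IsSyz K X) (h' : IsSyz K' X') :
    IsSyz (K ⊞ K') (X ⊞ X') := by
  obtain ⟨P, h1, h2, h3⟩ := h
  obtain ⟨P', h1', h2', h3'⟩ := h'
  exact ⟨P ⊞ P', fgMod_prod h1 h1', inferInstance, h3.prod h3'⟩

theorem SES.fg_left [IsNoetherianRing A] {X Y Z : ModuleCat.{u} A} (h : SES X Y Z)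
    (hY : fgMod A Y) : fgMod A X := by
  obtain ⟨f, _, hf, _⟩ := h
  have : Mono (ModuleCat.ofHom f) := (ModuleCat.mono_iff_injective _).2 hf
  exact fgMod_of_mono (ModuleCat.ofHom f) hY

theorem IsSyz.fg [IsNoetherianRing A] {K X : ModuleCat.{u} A} (h : IsSyz K X) : fgMod A K := by
  obtain ⟨P, h1, _, h3⟩ := h
  exact h3.fg_left h1

theorem IsSyz.hasProjectiveDimensionLE_iff {K X : ModuleCat.{u} A} (h : IsSyz K X) (n : ℕ) :
    HasProjectiveDimensionLE X (n + 1) ↔ HasProjectiveDimensionLE K n := by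
  obtain ⟨P, _, h2, h3⟩ := h
  obtain ⟨i, p, w, hS⟩ := h3.exists_shortExact
  exact hS.hasProjectiveDimensionLT_X₃_iff n h2

/-- Schanuel's lemma. -/
theorem IsSyz.schanuel {K K' X : ModuleCat.{u} A} (h : IsSyz K X) (h' : IsSyz K' X) :
    ∃ P P' : ModuleCat.{u} A, fgMod A P ∧ Projective P ∧ fgMod A P' ∧ Projective P' ∧
      Nonempty (P ⊞ K' ≅ K ⊞ P') := by
  obtain ⟨P, hPf, hP, f, g, hf, hg, hfg⟩ := h
  obtain ⟨P', hPf', hP', f', g', hf', hg', hfg'⟩ := h'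
  refine ⟨P, P', hPf, hP, hPf', hP', ?_⟩
  have hPm := (projective_iff P).1 hP
  obtain ⟨l, hl⟩ := Module.projective_lifting_property g' g hg'
  have hl' : ∀ x, g' (l x) = g x := fun x => LinearMap.congr_fun hl x
  have hlk : ∀ x : K, l (f x) ∈ LinearMap.range f' := fun x => by
    have := (hfg' (l (f x))).1 (by rw [hl', hfg.apply_apply_eq_zero])
    simpa using this
  let k : K →ₗ[A] K' := (LinearEquiv.ofInjective f' hf').symm.toLinearMap ∘ₗ
    (l ∘ₗ f).codRestrict (LinearMap.range f') hlk
  have hk : ∀ x, f' (k x) = l (f x) := fun x => by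
    have : (LinearEquiv.ofInjective f' hf') (k x) = ⟨l (f x), hlk x⟩ := by simp [k]; rfl
    exact congrArg Subtype.val this
  -- The lift `l : P → P'` and its restriction `k : K → K'` form a map of short exact sequences over
  -- the identity of `X`. Its mapping cone is this sequence, which splits because `P'` is
  -- projective.
  have hS : SES K (ModuleCat.of A (P × K')) P' := by
    refine ⟨f.prod k, l.coprod (-f'), ?_, ?_, ?_⟩
    · intro x y hxy
      exact hf (congrArg Prod.fst hxy)
    · intro y
      obtain ⟨x, hx⟩ := hg (g' y)
      obtain ⟨z, hz⟩ := (hfg' (l x - y)).1 (by rw [map_sub, hl', hx, sub_self])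
      exact ⟨(x, z), by simp [hz]⟩
    · rintro ⟨x, z⟩
      constructor
      · intro h0
        have h0 : l x = f' z := by
          simpa [LinearMap.coprod_apply, ← sub_eq_add_neg, sub_eq_zero] using h0
        obtain ⟨y, rfl⟩ := (hfg x).1 (by rw [← hl', h0, hfg'.apply_apply_eq_zero])
        exact ⟨y, Prod.ext rfl (hf' (by rw [← h0]; exact hk y))⟩
      · rintro ⟨y, hy⟩
        obtain ⟨rfl, rfl⟩ := Prod.ext_iff.1 hy
        simp [LinearMap.coprod_apply, hk]
  exact (hS.congr (Iso.refl _) (ModuleCat.biprodIsoProd P K').symm (Iso.refl _)).iso_of_projective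

end ShortExactSequences

/-! ### Existence of projective covers -/

section ProjectiveCovers

variable {A : Type u} [Ring A]

theorem ProjCover.fg {X : ModuleCat.{u} A} (c : ProjCover X) (hX : fgMod A X) : fgMod A c.P := by
  have : Module.Finite A X := hX
  obtain ⟨s, hs⟩ := Module.finite_def.1 this
  classical
  choose r hr using c.surjective
  let S : Submodule A c.P := Submodule.span A (s.image r : Finset c.P)
  have hS : S ⊔ LinearMap.ker c.p.hom = ⊤ := by
    rw [← Submodule.comap_map_eq, Submodule.map_span, Finset.coe_image, ← Set.image_comp]
    have : (c.p.hom ∘ r : X → X) = id := funext hr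
    rw [this, Set.image_id, hs, Submodule.comap_top]
  exact Module.finite_def.2 ⟨_, c.superfluous S hS⟩

theorem ProjCover.isSyz {X : ModuleCat.{u} A} (c : ProjCover X) (hX : fgMod A X) :
    IsSyz (ModuleCat.of A (LinearMap.ker c.p.hom)) X :=
  ⟨c.P, c.fg hX, c.projective, (LinearMap.ker c.p.hom).subtype, c.p.hom, Subtype.val_injective,
    c.surjective, fun x => by simp⟩

/-- Let `S` be minimal among the submodules of a finite free module that still map onto `X`. Lifting
`q` through `S` gives a map `g` to `S`; minimality makes `g` restricted to `S` surjective, hence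
bijective, so `S` is a retract of the free module. Minimality also says that the kernel of `S → X`
is superfluous. -/
theorem exists_projCover [IsArtinianRing A] (X : ModuleCat.{u} A) (hX : fgMod A X) :
    Nonempty (ProjCover X) := by
  have : Module.Finite A X := hX
  obtain ⟨n, q, hq⟩ := Module.Finite.exists_fin' A X
  obtain ⟨S, hS, hmin⟩ := WellFounded.has_min
    (wellFounded_lt (α := Submodule A (Fin n → A))) {S | S.map q = ⊤}
    ⟨⊤, by simpa [LinearMap.range_eq_top] using hq⟩
  have hmin' : ∀ N : Submodule A S, (N.map S.subtype).map q = ⊤ → N = ⊤ := by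
    intro N hN
    have h1 : N.map S.subtype ≤ S := Submodule.map_subtype_le S N
    have h2 : N.map S.subtype = S := by
      by_contra hne
      exact hmin _ hN (lt_of_le_of_ne h1 hne)
    rw [← Submodule.comap_map_eq_of_injective S.subtype_injective N, h2]
    simp
  have hp : Function.Surjective (q ∘ₗ S.subtype) := by
    rw [← LinearMap.range_eq_top, LinearMap.range_comp, Submodule.range_subtype]
    exact hS
  obtain ⟨g, hg⟩ := Module.projective_lifting_property (q ∘ₗ S.subtype) q hp
  have hs : Function.Surjective (g ∘ₗ S.subtype) := by
    rw [← LinearMap.range_eq_top]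
    apply hmin'
    rw [← LinearMap.range_comp, ← LinearMap.range_comp, ← LinearMap.comp_assoc,
      ← LinearMap.comp_assoc, hg]
    exact LinearMap.range_eq_top.2 hp
  have hb : Function.Bijective (g ∘ₗ S.subtype) :=
    ⟨IsNoetherian.injective_of_surjective_endomorphism _ hs, hs⟩
  let e := LinearEquiv.ofBijective _ hb
  have hproj : Module.Projective A S := Module.Projective.of_split S.subtype
    (e.symm.toLinearMap ∘ₗ g) (LinearMap.ext fun x => e.symm_apply_apply x)
  refine ⟨⟨ModuleCat.of A S, (projective_iff _).2 hproj, ModuleCat.ofHom (q ∘ₗ S.subtype), hp, ?_⟩⟩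
  intro N hN
  apply hmin'
  have := congrArg (Submodule.map (q ∘ₗ S.subtype)) hN
  rw [Submodule.map_sup, Submodule.map_top, LinearMap.range_eq_top.2 hp] at this
  rw [← Submodule.map_comp, ← this, eq_comm, sup_eq_left, Submodule.map_le_iff_le_comap]
  intro x hx
  have hx : (q ∘ₗ S.subtype) x = 0 := hx
  rw [Submodule.mem_comap, hx]
  exact Submodule.zero_mem _

theorem isSyz_syzygy [IsArtinianRing A] {X : ModuleCat.{u} A} (hX : fgMod A X) :
    IsSyz (syzygy X) X := by
  have h := exists_projCover X hX
  rw [syzygy, dif_pos h]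
  exact ProjCover.isSyz _ hX

theorem fg_syzygy [IsArtinianRing A] {X : ModuleCat.{u} A} (hX : fgMod A X) :
    fgMod A (syzygy X) :=
  (isSyz_syzygy hX).fg

theorem fg_syzygy_iterate [IsArtinianRing A] {X : ModuleCat.{u} A} (hX : fgMod A X) (k : ℕ) :
    fgMod A (syzygy^[k] X) := by
  induction k with
  | zero => exact hX
  | succ k ih => rw [Function.iterate_succ_apply']; exact fg_syzygy ih

end ProjectiveCovers

end GLIT

namespace GLIT

/-! ### Classes, stable isomorphism and the operator `L` -/

section StableClasses

variable {A : Type u} [Ring A]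

theorem indecClass_of_not_projective {Y : ModuleCat.{u} A} (h1 : fgMod A Y)
    (h2 : Indecomposable Y) (h3 : ¬ Projective Y) :
    indecClass Y = Finsupp.single (_root_.Quotient.mk (isoSetoid A) ⟨Y, h1, h2, h3⟩) 1 :=
  indecClass_eq ⟨Y, h1, h2, h3⟩

theorem projective_sumList {l : List (ModuleCat.{u} A)} (h : ∀ Y ∈ l, Projective Y) :
    Projective (sumList l) := by
  induction l with
  | nil => exact projective_of_isZero isZero_sumList_nil
  | cons Y l ih =>
    exact projective_biprod_iff.2 ⟨h Y List.mem_cons_self,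
      ih fun Z hZ => h Z (List.mem_cons_of_mem _ hZ)⟩

theorem fgMod_sumList {l : List (ModuleCat.{u} A)} (h : IndecList l) : fgMod A (sumList l) := by
  induction l with
  | nil => exact inferInstanceAs (Module.Finite A PUnit.{u + 1})
  | cons Y l ih =>
    exact fgMod_prod (h Y List.mem_cons_self).1 (ih fun Z hZ => h Z (List.mem_cons_of_mem _ hZ))

noncomputable def biprodLeftComm (X Y Z : ModuleCat.{u} A) : X ⊞ (Y ⊞ Z) ≅ Y ⊞ (X ⊞ Z) :=
  (biprod.associator X Y Z).symm ≪≫ biprod.mapIso (biprod.braiding X Y) (Iso.refl Z) ≪≫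
    biprod.associator Y X Z

theorem exists_sumList_iso_of_mem {l : List (ModuleCat.{u} A)} (hl : IndecList l)
    {Z : ModuleCat.{u} A} (hZ : Z ∈ l) :
    ∃ l' : List (ModuleCat.{u} A), IndecList l' ∧ Nonempty (sumList l ≅ Z ⊞ sumList l') ∧
      classList l = indecClass Z + classList l' := by
  induction l with
  | nil => simp at hZ
  | cons Y l ih =>
    have hl' : IndecList l := fun V hV => hl V (List.mem_cons_of_mem _ hV)
    rcases List.mem_cons.1 hZ with rfl | h
    · exact ⟨l, hl', ⟨Iso.refl _⟩, rfl⟩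
    · obtain ⟨l', h1, ⟨e⟩, h3⟩ := ih hl' h
      refine ⟨Y :: l', ?_, ⟨biprod.mapIso (Iso.refl Y) e ≪≫ biprodLeftComm Y Z _⟩, ?_⟩
      · intro V hV
        rcases List.mem_cons.1 hV with rfl | hV
        exacts [hl _ List.mem_cons_self, h1 V hV]
      · simp only [classList, List.map_cons, List.sum_cons] at h3 ⊢
        rw [h3]; abel

theorem indecClass_ne_zero {Y : ModuleCat.{u} A} (h1 : fgMod A Y) (h2 : Indecomposable Y)
    (h3 : ¬ Projective Y) : indecClass Y ≠ 0 := by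
  rw [indecClass_eq ⟨Y, h1, h2, h3⟩]
  exact Finsupp.single_ne_zero.2 one_ne_zero

theorem projective_of_classList_eq_zero {l : List (ModuleCat.{u} A)} (hl : IndecList l)
    (h : classList l = 0) : Projective (sumList l) := by
  refine projective_sumList fun Y hY => ?_
  by_contra hp
  obtain ⟨l', _, _, h3⟩ := exists_sumList_iso_of_mem hl hY
  refine indecClass_ne_zero (hl Y hY).1 (hl Y hY).2 hp (le_antisymm ?_ (indecClass_nonneg Y))
  rw [← h, h3]
  exact le_add_of_nonneg_right (classList_nonneg l')

theorem exists_mem_of_classList_ne_zero {l : List (ModuleCat.{u} A)} (hl : IndecList l)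
    {q : _root_.Quotient (isoSetoid A)} (h : classList l q ≠ 0) :
    ∃ Y : IndecNonProj A, Y.1 ∈ l ∧ _root_.Quotient.mk (isoSetoid A) Y = q := by
  induction l with
  | nil => simp [classList] at h
  | cons Z l ih =>
    have hl' : IndecList l := fun V hV => hl V (List.mem_cons_of_mem _ hV)
    by_cases h' : classList l q = 0
    · have hZ : indecClass Z q ≠ 0 := by
        intro h0
        apply h
        simp only [classList, List.map_cons, List.sum_cons] at h' ⊢
        rw [Finsupp.add_apply, h', h0, add_zero]
      have hp : ¬ Projective Z := fun hp => hZ (by rw [indecClass_of_projective hp]; rfl)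
      have hZ' := hl Z List.mem_cons_self
      refine ⟨⟨Z, hZ'.1, hZ'.2, hp⟩, List.mem_cons_self, ?_⟩
      rw [indecClass_eq ⟨Z, hZ'.1, hZ'.2, hp⟩] at hZ
      by_contra hne
      exact hZ (Finsupp.single_eq_of_ne' hne)
    · obtain ⟨Y, h1, h2⟩ := ih hl' h'
      exact ⟨Y, List.mem_cons_of_mem _ h1, h2⟩

/-- Coefficients are nonnegative, so nothing cancels: a non-projective member of one list occurs up
to isomorphism in the other and can be removed from both. The projective members are absorbed into
`P` and `Q`. -/
theorem exists_stable_iso_of_classList_eq {l l' : List (ModuleCat.{u} A)} (hl : IndecList l)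
    (hl' : IndecList l') (h : classList l = classList l') :
    ∃ P Q : ModuleCat.{u} A, fgMod A P ∧ Projective P ∧ fgMod A Q ∧ Projective Q ∧
      Nonempty (sumList l ⊞ P ≅ sumList l' ⊞ Q) := by
  induction l generalizing l' with
  | nil =>
    have hp := projective_of_classList_eq_zero hl' h.symm
    exact ⟨sumList l', _, fgMod_sumList hl', hp, fgMod_sumList hl, projective_sumList (by simp),
      ⟨biprod.braiding _ _⟩⟩
  | cons Y l ih =>
    have hl0 : IndecList l := fun V hV => hl V (List.mem_cons_of_mem _ hV)
    have hY := hl Y List.mem_cons_self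
    have hc : classList (Y :: l) = indecClass Y + classList l := by simp [classList]
    by_cases hp : Projective Y
    · rw [hc, indecClass_of_projective hp, zero_add] at h
      obtain ⟨P, Q, h1, h2, h3, h4, ⟨e⟩⟩ := ih hl0 hl' h
      refine ⟨P, Y ⊞ Q, h1, h2, fgMod_prod hY.1 h3, inferInstance, ⟨?_⟩⟩
      exact biprod.associator Y _ P ≪≫ biprod.mapIso (Iso.refl Y) e ≪≫ biprodLeftComm _ _ _
    · have hne : classList l' (_root_.Quotient.mk (isoSetoid A) ⟨Y, hY.1, hY.2, hp⟩) ≠ 0 := by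
        rw [← h, hc, indecClass_of_not_projective hY.1 hY.2 hp, Finsupp.add_apply,
          Finsupp.single_eq_same]
        have := classList_nonneg l (_root_.Quotient.mk (isoSetoid A) ⟨Y, hY.1, hY.2, hp⟩)
        have : (0 : ℤ) ≤ classList l (_root_.Quotient.mk (isoSetoid A) ⟨Y, hY.1, hY.2, hp⟩) := this
        omega
      obtain ⟨Z, hZ, hZY⟩ := exists_mem_of_classList_ne_zero hl' hne
      obtain ⟨eZ⟩ : Nonempty (Z.1 ≅ Y) := Quotient.exact hZY
      obtain ⟨l'', h1, ⟨f⟩, h3⟩ := exists_sumList_iso_of_mem hl' hZ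
      rw [hc, h3, indecClass_congr eZ] at h
      obtain ⟨P, Q, g1, g2, g3, g4, ⟨e⟩⟩ := ih hl0 h1 (add_left_cancel h)
      refine ⟨P, Q, g1, g2, g3, g4, ⟨biprod.associator Y _ P ≪≫ biprod.mapIso eZ.symm e ≪≫
        (biprod.associator _ _ _).symm ≪≫ biprod.mapIso f.symm (Iso.refl Q)⟩⟩

variable [IsArtinianRing A]

theorem modClass_of_projective {X : ModuleCat.{u} A} (hX : fgMod A X) (h : Projective X) :
    modClass X = 0 := by
  obtain ⟨l, hl, ⟨e⟩⟩ := exists_indecList X hX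
  rw [modClass_eq_classList hl e, classList]
  refine List.sum_eq_zero fun x hx => ?_
  obtain ⟨Y, hY, rfl⟩ := List.mem_map.1 hx
  obtain ⟨l', _, ⟨f⟩, _⟩ := exists_sumList_iso_of_mem hl hY
  exact indecClass_of_projective
    (projective_biprod_iff.1 ((projective_iff_of_iso (e ≪≫ f)).1 h)).1

theorem modClass_eq_zero_iff {X : ModuleCat.{u} A} (hX : fgMod A X) :
    modClass X = 0 ↔ Projective X := by
  refine ⟨fun h => ?_, modClass_of_projective hX⟩
  obtain ⟨l, hl, ⟨e⟩⟩ := exists_indecList X hX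
  rw [modClass_eq_classList hl e] at h
  exact (projective_iff_of_iso e).2 (projective_of_classList_eq_zero hl h)

theorem exists_stable_iso_of_modClass_eq {X Y : ModuleCat.{u} A} (hX : fgMod A X)
    (hY : fgMod A Y) (h : modClass X = modClass Y) :
    ∃ P Q : ModuleCat.{u} A, fgMod A P ∧ Projective P ∧ fgMod A Q ∧ Projective Q ∧
      Nonempty (X ⊞ P ≅ Y ⊞ Q) := by
  obtain ⟨l, hl, ⟨e⟩⟩ := exists_indecList X hX
  obtain ⟨l', hl', ⟨e'⟩⟩ := exists_indecList Y hY
  rw [modClass_eq_classList hl e, modClass_eq_classList hl' e'] at h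
  obtain ⟨P, Q, h1, h2, h3, h4, ⟨f⟩⟩ := exists_stable_iso_of_classList_eq hl hl' h
  exact ⟨P, Q, h1, h2, h3, h4,
    ⟨biprod.mapIso e (Iso.refl P) ≪≫ f ≪≫ biprod.mapIso e'.symm (Iso.refl Q)⟩⟩

theorem exists_summand_of_modClass_ne_zero {X : ModuleCat.{u} A} (hX : fgMod A X)
    {q : _root_.Quotient (isoSetoid A)} (h : modClass X q ≠ 0) :
    ∃ Y : IndecNonProj A, _root_.Quotient.mk (isoSetoid A) Y = q ∧
      ∃ W : ModuleCat.{u} A, Nonempty (X ≅ Y.1 ⊞ W) := by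
  obtain ⟨l, hl, ⟨e⟩⟩ := exists_indecList X hX
  rw [modClass_eq_classList hl e] at h
  obtain ⟨Y, h1, h2⟩ := exists_mem_of_classList_ne_zero hl h
  obtain ⟨l', _, ⟨f⟩, _⟩ := exists_sumList_iso_of_mem hl h1
  exact ⟨Y, h2, sumList l', ⟨e ≪≫ f⟩⟩

theorem modClass_sumList {l : List (ModuleCat.{u} A)} (h : ∀ Y ∈ l, fgMod A Y) :
    fgMod A (sumList l) ∧ modClass (sumList l) = (l.map modClass).sum := by
  induction l with
  | nil =>
    have h0 : fgMod A (sumList ([] : List (ModuleCat.{u} A))) :=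
      inferInstanceAs (Module.Finite A PUnit.{u + 1})
    exact ⟨h0, modClass_of_projective h0 (projective_of_isZero isZero_sumList_nil)⟩
  | cons Y l ih =>
    have h1 := h Y List.mem_cons_self
    have h2 := ih fun Z hZ => h Z (List.mem_cons_of_mem _ hZ)
    exact ⟨fgMod_prod h1 h2.1, (modClass_biprod h1 h2.1).trans (by rw [h2.2]; rfl)⟩

/-- Schanuel's lemma together with the vanishing of projective classes. Thus projective covers can
be replaced by arbitrary finitely generated projective presentations when applying `L`. -/
theorem modClass_isSyz_eq {K K' X : ModuleCat.{u} A} (h : IsSyz K X) (h' : IsSyz K' X) :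
    modClass K = modClass K' := by
  obtain ⟨P, P', h1, h2, h3, h4, ⟨e⟩⟩ := h.schanuel h'
  have := modClass_congr (fgMod_prod h1 h'.fg) e
  rw [modClass_biprod h1 h'.fg, modClass_biprod h.fg h3, modClass_of_projective h1 h2,
    modClass_of_projective h3 h4, zero_add, add_zero] at this
  exact this.symm

theorem syzygyMap_indecClass {Y : ModuleCat.{u} A} (hY : fgMod A Y) (hi : Indecomposable Y) :
    ∃ K, IsSyz K Y ∧ modClass K = syzygyMap A (indecClass Y) := by
  by_cases hp : Projective Y
  · have h0 : fgMod A (ModuleCat.of A PUnit.{u + 1}) := inferInstanceAs (Module.Finite A PUnit.{u + 1})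
    refine ⟨ModuleCat.of A PUnit, ⟨Y, hY, hp, SES.zero_left Y⟩, ?_⟩
    rw [indecClass_of_projective hp, map_zero, modClass_of_projective h0
      (projective_of_isZero (ModuleCat.isZero_of_subsingleton _))]
  · set q := _root_.Quotient.mk (isoSetoid A) ⟨Y, hY, hi, hp⟩ with hq
    -- `syzygyMap` uses the representative `Quotient.out q`, which is only isomorphic to `Y`.
    obtain ⟨e⟩ : Nonempty ((_root_.Quotient.out q).1 ≅ Y) := Quotient.exact (Quotient.out_eq q)
    refine ⟨syzygy (_root_.Quotient.out q).1,
      (isSyz_syzygy (_root_.Quotient.out q).2.1).congr (Iso.refl _) e, ?_⟩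
    rw [indecClass_of_not_projective hY hi hp, syzygyMap]
    exact ((Finsupp.linearCombination_single ℤ (1 : ℤ) q).trans (one_smul ℤ
      (modClass (syzygy (_root_.Quotient.out q).1)))).symm

/-- The endomorphism `L` computes classes of syzygies. -/
theorem syzygyMap_modClass {K X : ModuleCat.{u} A} (hX : fgMod A X) (h : IsSyz K X) :
    syzygyMap A (modClass X) = modClass K := by
  obtain ⟨l, hl, ⟨e⟩⟩ := exists_indecList X hX
  rw [modClass_eq_classList hl e]
  suffices ∃ K', IsSyz K' (sumList l) ∧ modClass K' = syzygyMap A (classList l) by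
    obtain ⟨K', h1, h2⟩ := this
    rw [← h2]
    exact modClass_isSyz_eq h1 (h.congr (Iso.refl K) e)
  clear e
  induction l with
  | nil =>
    have h0 : fgMod A (ModuleCat.of A PUnit.{u + 1}) := inferInstanceAs (Module.Finite A PUnit.{u + 1})
    have hp := projective_of_isZero (isZero_sumList_nil (A := A))
    refine ⟨_, ⟨_, h0, hp, SES.zero_left _⟩, ?_⟩
    rw [classList, List.map_nil, List.sum_nil, map_zero, modClass_of_projective h0 hp]
  | cons Y l ih =>
    obtain ⟨K, h1, h2⟩ := ih fun V hV => hl V (List.mem_cons_of_mem _ hV)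
    obtain ⟨K', h1', h2'⟩ := syzygyMap_indecClass (hl Y List.mem_cons_self).1
      (hl Y List.mem_cons_self).2
    refine ⟨K' ⊞ K, h1'.prod h1, ?_⟩
    rw [modClass_biprod h1'.fg h1.fg, h2, h2', ← map_add]
    simp [classList]

theorem modClass_syzygy_iterate {X : ModuleCat.{u} A} (hX : fgMod A X) (k : ℕ) :
    modClass (syzygy^[k] X) = (syzygyMap A ^ k) (modClass X) := by
  induction k with
  | zero => rfl
  | succ k ih =>
    rw [Function.iterate_succ_apply', pow_succ', Module.End.mul_apply, ← ih]
    exact (syzygyMap_modClass (fg_syzygy_iterate hX k)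
      (isSyz_syzygy (fg_syzygy_iterate hX k))).symm

theorem hasProjectiveDimensionLE_syzygy_iterate {X : ModuleCat.{u} A} (hX : fgMod A X) (n k : ℕ) :
    HasProjectiveDimensionLE X (n + k) ↔ HasProjectiveDimensionLE (syzygy^[k] X) n := by
  induction k generalizing n with
  | zero => rfl
  | succ k ih =>
    rw [Function.iterate_succ_apply', ← (isSyz_syzygy (fg_syzygy_iterate hX k)).hasProjectiveDimensionLE_iff,
      ← ih, add_right_comm, add_assoc]

/-- Translates projective dimension into vanishing under powers of `L`, since the class of a module
is zero exactly when the module is projective. -/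
theorem hasProjectiveDimensionLE_iff_syzygyMap {X : ModuleCat.{u} A} (hX : fgMod A X) (k : ℕ) :
    HasProjectiveDimensionLE X k ↔ (syzygyMap A ^ k) (modClass X) = 0 := by
  rw [← modClass_syzygy_iterate hX, modClass_eq_zero_iff (fg_syzygy_iterate hX k),
    projective_iff_hasProjectiveDimensionLE_zero, ← hasProjectiveDimensionLE_syzygy_iterate hX,
    zero_add]

theorem syzygyMap_nonneg {x : KProj A} (hx : 0 ≤ x) : 0 ≤ syzygyMap A x := by
  rw [syzygyMap, Finsupp.linearCombination_apply, Finsupp.sum]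
  exact Finset.sum_nonneg fun q _ =>
    smul_nonneg (hx q) (modClass_nonneg (fg_syzygy (_root_.Quotient.out q).2.1))

theorem syzygyMap_pow_nonneg {x : KProj A} (hx : 0 ≤ x) (k : ℕ) : 0 ≤ (syzygyMap A ^ k) x := by
  induction k with
  | zero => exact hx
  | succ k ih => rw [pow_succ', Module.End.mul_apply]; exact syzygyMap_nonneg ih

theorem syzygyMap_pow_mono {x y : KProj A} (h : x ≤ y) (k : ℕ) :
    (syzygyMap A ^ k) x ≤ (syzygyMap A ^ k) y := by
  rw [← sub_nonneg, ← map_sub]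
  exact syzygyMap_pow_nonneg (sub_nonneg.2 h) k

end StableClasses

end GLIT

namespace GLIT

/-! ### Rank stabilisation and uniform nilpotency -/

section Ranks

variable {K : Type*} [AddCommGroup K] (L : Module.End ℤ K)

theorem pow_apply_eq_zero_of_le {x : K} {j k : ℕ} (hjk : j ≤ k) (h : (L ^ j) x = 0) :
    (L ^ k) x = 0 := by
  obtain ⟨i, rfl⟩ := Nat.exists_eq_add_of_le' hjk
  rw [pow_add, Module.End.mul_apply, h, map_zero]

/-- From `n` on, `L` maps `L^k S` onto `L^(k+1) S`, and these are free of the same finite rank, so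
it is injective there. Descending from `j` to `n` one factor of `L` at a time gives the claim. -/
theorem pow_apply_eq_zero_of_finrank_eq [Module.Free ℤ K] (S : Submodule ℤ K) (hS : S.FG) (n : ℕ)
    (h : ∀ k, n ≤ k →
      Module.finrank ℤ (S.map (L ^ k)) = Module.finrank ℤ (S.map (L ^ (k + 1))))
    {x : K} (hx : x ∈ S) (j : ℕ) (hj : (L ^ j) x = 0) : (L ^ n) x = 0 := by
  have inj : ∀ k, n ≤ k → (L ^ (k + 1)) x = 0 → (L ^ k) x = 0 := by
    intro k hk h0
    have hfin1 : Module.Finite ℤ (S.map (L ^ k)) := Module.Finite.iff_fg.2 (hS.map _)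
    have hfin2 : Module.Finite ℤ (S.map (L ^ (k + 1))) := Module.Finite.iff_fg.2 (hS.map _)
    let f : S.map (L ^ k) →ₗ[ℤ] S.map (L ^ (k + 1)) := L.restrict (by
      rintro _ ⟨y, hy, rfl⟩
      exact ⟨y, hy, by rw [pow_succ']; rfl⟩)
    have hf : Function.Surjective f := by
      rintro ⟨_, y, hy, rfl⟩
      exact ⟨⟨(L ^ k) y, y, hy, rfl⟩, Subtype.ext (LinearMap.congr_fun (pow_succ' L k) y).symm⟩
    let e := LinearEquiv.ofFinrankEq _ _ (h k hk)
    have hi : Function.Injective (e.symm.toLinearMap ∘ₗ f) :=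
      IsNoetherian.injective_of_surjective_endomorphism _ (e.symm.surjective.comp hf)
    have h1 : (⟨(L ^ k) x, x, hx, rfl⟩ : S.map (L ^ k)) = 0 := by
      apply hi
      have : f ⟨(L ^ k) x, x, hx, rfl⟩ = 0 := Subtype.ext (by
        rw [pow_succ'] at h0; exact h0)
      rw [LinearMap.comp_apply, this, map_zero, map_zero]
    exact congrArg Subtype.val h1
  by_cases hjn : j ≤ n
  · exact pow_apply_eq_zero_of_le L hjn hj
  · obtain ⟨i, rfl⟩ := Nat.exists_eq_add_of_le (le_of_not_ge hjn)
    clear hjn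
    induction i with
    | zero => exact hj
    | succ i ih => exact ih (inj (n + i) (Nat.le_add_right _ _) hj)

/-- The least `n` from which on the ranks of `L^k S` do not change. -/
theorem exists_finrank_map_pow_eq [Module.Free ℤ K] (S : Submodule ℤ K) (hS : S.FG) :
    ∃ n, ∀ k, n ≤ k →
      Module.finrank ℤ (S.map (L ^ k)) = Module.finrank ℤ (S.map (L ^ (k + 1))) := by
  have hanti : Antitone fun k => Module.finrank ℤ (S.map (L ^ k)) := by
    refine antitone_nat_of_succ_le fun k => ?_
    have : Module.Finite ℤ (S.map (L ^ k)) := Module.Finite.iff_fg.2 (hS.map _)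
    have h1 : S.map (L ^ (k + 1)) = (S.map (L ^ k)).map L := by
      rw [pow_succ', ← Submodule.map_comp]; rfl
    show Module.finrank ℤ (S.map (L ^ (k + 1))) ≤ _
    rw [h1]
    exact Submodule.finrank_map_le _ _
  obtain ⟨n, hn⟩ := WellFounded.has_min (wellFounded_lt (α := ℕ))
    (Set.range fun k => Module.finrank ℤ (S.map (L ^ k))) (Set.range_nonempty _)
  obtain ⟨⟨n, rfl⟩, hn⟩ := hn
  refine ⟨n, fun k hk => ?_⟩
  have h1 := hanti hk
  have h2 := hanti (hk.trans (Nat.le_succ k))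
  have h3 := not_lt.1 (hn _ ⟨k, rfl⟩)
  have h4 := not_lt.1 (hn _ ⟨k + 1, rfl⟩)
  exact (le_antisymm h1 h3).trans (le_antisymm h2 h4).symm

/-- The elements of `F` lying in `ker L^j + B` form an ascending chain in a noetherian module, which
stops at some `n`. If `L^j` kills `v + b`, then `v = z + c` with `L^n z = 0` and `c ∈ B`. The
remaining `c + b` lies in `B` and is killed by a power of `L`, hence by `L^d`. -/
theorem exists_uniform_nilpotency (F B : Submodule ℤ K) (hF : F.FG) (d : ℕ)
    (hB : ∀ x ∈ B, ∀ j, (L ^ j) x = 0 → (L ^ d) x = 0) :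
    ∃ m, ∀ x ∈ F ⊔ B, ∀ j, (L ^ j) x = 0 → (L ^ m) x = 0 := by
  have : Module.Finite ℤ F := Module.Finite.iff_fg.2 hF
  have hmono : ∀ j k, j ≤ k → LinearMap.ker (L ^ j) ≤ LinearMap.ker (L ^ k) :=
    fun j k hjk x hx => pow_apply_eq_zero_of_le L hjk hx
  let W : ℕ →o Submodule ℤ F :=
    ⟨fun j => (LinearMap.ker (L ^ j) ⊔ B).comap F.subtype,
      fun j k hjk => Submodule.comap_mono (sup_le_sup_right (hmono j k hjk) B)⟩
  obtain ⟨n, hn⟩ := monotone_stabilizes_iff_noetherian.2 (inferInstance : IsNoetherian ℤ F) W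
  refine ⟨max n d, fun x hx j hj => ?_⟩
  obtain ⟨v, hv, b, hb, rfl⟩ := Submodule.mem_sup.1 hx
  have hvW : (⟨v, hv⟩ : F) ∈ W (max n j) := by
    refine Submodule.mem_sup.2 ⟨v + b, hmono j _ (le_max_right _ _) hj, -b, B.neg_mem hb, ?_⟩
    simp
  rw [← hn _ (le_max_left n j)] at hvW
  obtain ⟨z, hz, c, hc, hzc⟩ := Submodule.mem_sup.1 hvW
  have hzc : z + c = v := hzc
  subst hzc
  have h1 : (L ^ max n j) (c + b) = 0 := by
    have e1 := pow_apply_eq_zero_of_le L (le_max_right n j) hj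
    have e2 := pow_apply_eq_zero_of_le L (le_max_left n j) hz
    rwa [add_assoc, map_add, e2, zero_add] at e1
  have h2 := hB _ (B.add_mem hc hb) _ h1
  rw [add_assoc, map_add, pow_apply_eq_zero_of_le L (le_max_left n d) hz,
    pow_apply_eq_zero_of_le L (le_max_right n d) h2, add_zero]

end Ranks

/-! ### Finitistic dimension as a uniform bound -/

section FinDim

variable {A : Type u} [Ring A]

theorem finDim_le_iff (n : ℕ) : finDim A ≤ n ↔ ∀ X : ModuleCat.{u} A, fgMod A X →
    (∃ k, HasProjectiveDimensionLE X k) → HasProjectiveDimensionLE X n := by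
  constructor
  · intro h X hX hk
    rw [← projectiveDimension_ne_top_iff] at hk
    rw [← projectiveDimension_le_iff]
    generalize hd : projectiveDimension X = d at hk
    induction d with
    -- The zero module.
    | bot => exact bot_le
    | coe d =>
      have hd' : d ≠ ⊤ := fun h => hk (by rw [h]; rfl)
      have h1 : d ≤ finDim A := le_sSup ⟨hd', X, hX, hd⟩
      exact WithBot.coe_le_coe.2 (h1.trans h)
  · intro h
    refine sSup_le ?_
    rintro d ⟨hd, X, hX, hXd⟩
    have h1 := h X hX ((projectiveDimension_ne_top_iff X).1 (by
      rw [hXd]; exact fun h => hd (WithBot.coe_eq_coe.1 h)))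
    rw [← projectiveDimension_le_iff, hXd] at h1
    exact WithBot.coe_le_coe.1 h1

theorem finDim_ne_top_iff : finDim A ≠ ⊤ ↔ ∃ n : ℕ, ∀ X : ModuleCat.{u} A, fgMod A X →
    (∃ k, HasProjectiveDimensionLE X k) → HasProjectiveDimensionLE X n := by
  simp only [← finDim_le_iff]
  constructor
  · intro h
    obtain ⟨n, hn⟩ := ENat.ne_top_iff_exists.1 h
    exact ⟨n, hn.symm.le⟩
  · rintro ⟨n, hn⟩ h
    rw [h] at hn
    exact absurd hn (by simp)

end FinDim

/-! ### Additive closures -/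

section AddClosure

variable {A : Type u} [Ring A] {D : ObjectProperty (ModuleCat.{u} A)}

theorem addClosure_le (h0 : ∀ Z, IsZero Z → D Z) (h2 : ∀ X Y, D X → D Y → D (X ⊞ Y))
    (hr : ∀ X Y, Retract X Y → D Y → D X) {X : ModuleCat.{u} A} (hX : addClosure D X) : D X := by
  obtain ⟨n, Y, W, hY, ⟨e⟩⟩ := hX
  have h : ∀ l : List (ModuleCat.{u} A), (∀ Y ∈ l, D Y) → D (sumList l) := by
    intro l
    induction l with
    | nil => exact fun _ => h0 _ isZero_sumList_nil
    | cons Y l ih =>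
      exact fun h => h2 _ _ (h Y List.mem_cons_self)
        (ih fun Z hZ => h Z (List.mem_cons_of_mem _ hZ))
  refine hr X _ ⟨biprod.inl ≫ e.inv ≫ (biproductIsoSumList Y).hom,
    (biproductIsoSumList Y).inv ≫ e.hom ≫ biprod.fst, by simp⟩ (h (List.ofFn Y) fun Z hZ => ?_)
  obtain ⟨i, rfl⟩ := (List.mem_ofFn' _ _).1 hZ
  exact hY i

theorem addClosure_of_retract_sumList (l : List (ModuleCat.{u} A)) (hl : ∀ Y ∈ l, D Y)
    {X W : ModuleCat.{u} A} (e : sumList l ≅ X ⊞ W) : addClosure D X := by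
  have hY : List.ofFn (fun i : Fin l.length => l.get i) = l := List.ofFn_get l
  exact ⟨l.length, fun i => l.get i, W, fun i => hl _ (List.get_mem l i),
    ⟨biproductIsoSumList _ ≪≫ eqToIso (by rw [hY]) ≪≫ e⟩⟩

theorem le_addClosure {X : ModuleCat.{u} A} (h : D X) : addClosure D X :=
  addClosure_of_retract_sumList [X] (by simpa using h) (Iso.refl (X ⊞ sumList []))

theorem sumList_of_addClosure_eq (hD : addClosure D = D) (l : List (ModuleCat.{u} A))
    (hl : ∀ Y ∈ l, D Y) : D (sumList l) := by
  rw [← hD]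
  exact addClosure_of_retract_sumList l hl (biprodZeroIso isZero_sumList_nil).symm

theorem summand_of_addClosure_eq (hD : addClosure D = D) {X Y W : ModuleCat.{u} A}
    (hX : D X) (e : X ≅ Y ⊞ W) : D Y := by
  rw [← hD]
  exact addClosure_of_retract_sumList [X] (by simpa using hX)
    (biprodZeroIso isZero_sumList_nil ≪≫ e)

end AddClosure

/-! ### Finite finitistic dimension implies special GLIT -/

section FiniteImpliesGLIT

variable {A : Type u} [Ring A]

theorem hasProjectiveDimensionLE_of_le {X : ModuleCat.{u} A} {m n : ℕ} (h : m ≤ n)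
    (hX : HasProjectiveDimensionLE X m) : HasProjectiveDimensionLE X n :=
  hasProjectiveDimensionLT_of_ge X (m + 1) (n + 1) (Nat.succ_le_succ h)

variable [IsArtinianRing A]

/-- Every summand of `X` also has projective dimension at most `n`, so `L^k ⟨X⟩ = 0` for all `k ≥
n`. -/
theorem phi_le_of_hasProjectiveDimensionLE {X : ModuleCat.{u} A} (n : ℕ)
    (h : HasProjectiveDimensionLE X n) : Phi X ≤ n := by
  refine Nat.sInf_le fun k hk => ?_
  have hbot : ∀ k, n ≤ k → (summandGroup X).map (syzygyMap A ^ k) = ⊥ := by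
    intro k hk
    rw [eq_bot_iff, Submodule.map_le_iff_le_comap, summandGroup, Submodule.span_le]
    rintro _ ⟨Y, ⟨W, ⟨e⟩⟩, rfl⟩
    have hY : HasProjectiveDimensionLE Y.1 n :=
      Retract.hasProjectiveDimensionLT (Y := X)
        ⟨biprod.inl ≫ e.inv, e.hom ≫ biprod.fst, by simp⟩ (n + 1)
    have h1 := (hasProjectiveDimensionLE_iff_syzygyMap Y.2.1 k).1
      (hasProjectiveDimensionLE_of_le hk hY)
    rw [modClass_basis] at h1
    exact h1
  rw [syzygyRank, syzygyRank, hbot k hk, hbot (k + 1) (Nat.le_succ_of_le hk)]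

/-- The data are `t = 1`, `V = 0` and `𝒟` the class of all modules of finite projective dimension,
with the sequence `0 → 0 → X → X → 0`. -/
theorem isSpecialGLIT_of_finDim_ne_top (h : finDim A ≠ ⊤) : IsSpecialGLIT A := by
  obtain ⟨n, hn⟩ := finDim_ne_top_iff.1 h
  have hmem : ∀ X, finPD (fgMod A) X ↔ fgMod A X ∧ ∃ k, HasProjectiveDimensionLE X k :=
    fun X => and_congr_right fun _ => projectiveDimension_ne_top_iff X
  let O : ModuleCat.{u} A := ModuleCat.of A PUnit
  have hO : IsZero O := ModuleCat.isZero_of_subsingleton _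
  have hOf : fgMod A O := inferInstanceAs (Module.Finite A PUnit.{u + 1})
  have h0 : ∀ Z : ModuleCat.{u} A, IsZero Z → finPD (fgMod A) Z := fun Z hZ => by
    exact (hmem Z).2 ⟨fgMod_of_iso (hO.iso hZ) hOf, 0,
      (projective_iff_hasProjectiveDimensionLE_zero Z).1 (projective_of_isZero hZ)⟩
  refine ⟨1, O, finPD (fgMod A), le_rfl, fun X hX => hX.1, ?_, ?_, ⟨n, ?_⟩, hOf, ?_⟩
  · refine le_antisymm (fun X hX => addClosure_le h0 ?_ ?_ hX) fun X hX => le_addClosure hX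
    · intro X Y hX hY
      obtain ⟨hXf, a, ha⟩ := (hmem X).1 hX
      obtain ⟨hYf, b, hb⟩ := (hmem Y).1 hY
      have ha' := hasProjectiveDimensionLE_of_le (le_max_left a b) ha
      have hb' := hasProjectiveDimensionLE_of_le (le_max_right a b) hb
      exact (hmem _).2 ⟨fgMod_prod hXf hYf, max a b, inferInstance⟩
    · intro X Y r hY
      obtain ⟨hYf, b, hb⟩ := (hmem Y).1 hY
      exact (hmem X).2 ⟨fgMod_of_retract r hYf, b, r.hasProjectiveDimensionLT (b + 1)⟩
  · intro X hX
    obtain ⟨hXf, k, hk⟩ := (hmem X).1 hX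
    exact (hmem _).2 ⟨fg_syzygy hXf, k, ((isSyz_syzygy hXf).hasProjectiveDimensionLE_iff k).1
      (hasProjectiveDimensionLE_of_le (Nat.le_succ k) hk)⟩
  · intro X hX
    obtain ⟨hXf, hk⟩ := (hmem X).1 hX
    exact phi_le_of_hasProjectiveDimensionLE n (hn X hXf hk)
  · intro X hX
    exact ⟨O, O, O, X, le_addClosure rfl, h0 O hO, le_addClosure rfl, hX,
      ((SES.zero_left X).congr (hO.iso ((biprod_isZero_iff O O).2 ⟨hO, hO⟩))
        (zeroBiprodIso hO).symm (Iso.refl X)).exists_shortExact⟩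

end FiniteImpliesGLIT

end GLIT

namespace GLIT

/-! ### Cancellation through Ext and Fitting's lemma -/

section ExtCancellation

universe v w

open Abelian

variable {C : Type w} [Category.{v} C]

/-- Powers of an endomorphism. -/
def endPow {E : C} (f : E ⟶ E) : ℕ → (E ⟶ E)
  | 0 => 𝟙 E
  | n + 1 => endPow f n ≫ f

theorem endPow_succ' {E : C} (f : E ⟶ E) (n : ℕ) : endPow f (n + 1) = f ≫ endPow f n := by
  induction n with
  | zero => simp [endPow]
  | succ n ih =>
    calc endPow f (n + 1) ≫ f = (f ≫ endPow f n) ≫ f := by rw [ih]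
      _ = f ≫ endPow f (n + 1) := Category.assoc _ _ _

variable [Abelian C]

/-- The map on `Ext` induced by a morphism in the first variable. -/
noncomputable abbrev extPre [HasExt.{max w v} C] {X Y : C} (f : X ⟶ Y) {T : C} {l : ℕ}
    (x : Ext.{max w v} Y T l) : Ext.{max w v} X T l := (Ext.mk₀ f).comp x (zero_add l)

section

variable [HasExt.{max w v} C] {X Y Z : C} {T : C} {l : ℕ}

theorem extPre_comp (f : X ⟶ Y) (g : Y ⟶ Z) (x : Ext.{max w v} Z T l) :
    extPre (f ≫ g) x = extPre f (extPre g x) :=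
  (Ext.mk₀_comp_mk₀_assoc f g x).symm

theorem extPre_id (x : Ext.{max w v} X T l) : extPre (𝟙 X) x = x := Ext.mk₀_id_comp x

theorem extPre_add (f g : X ⟶ Y) (x : Ext.{max w v} Y T l) :
    extPre (f + g) x = extPre f x + extPre g x := by
  simp [extPre, Ext.mk₀_add, Ext.add_comp]

theorem extPre_zero_left (x : Ext.{max w v} Y T l) : extPre (0 : X ⟶ Y) x = 0 := by
  simp [extPre]

theorem extPre_zero_right (f : X ⟶ Y) : extPre f (0 : Ext.{max w v} Y T l) = 0 := by
  simp [extPre]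

theorem extPre_biprod_projective {E P : C} [Projective P] (x : Ext.{max w v} (E ⊞ P) T (l + 1)) :
    x = extPre biprod.fst (extPre biprod.inl x) := by
  have h : extPre (biprod.fst ≫ biprod.inl + biprod.snd ≫ biprod.inr) x = x := by
    rw [biprod.total, extPre_id]
  rw [extPre_add, extPre_comp, extPre_comp,
    Ext.eq_zero_of_projective (extPre biprod.inr x), extPre_zero_right, add_zero] at h
  exact h.symm

end

variable {E P X : C} [Projective P] {i : E ⟶ E ⊞ P} {p : E ⊞ P ⟶ X} {w : i ≫ p = 0}
  (hS : (ShortComplex.mk i p w).ShortExact) {Z : C} {ι : Z ⟶ E} {r : E ⟶ Z} {n : ℕ}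

include hS

/-- In degrees above `N` the Ext groups of `X` vanish, so `i` induces surjections on Ext. As `P`
contributes nothing in positive degrees, the component `E → E` and all its powers induce surjections
too. A power that vanishes on the retract `Z` then forces the Ext groups of `Z` to vanish. -/
theorem hasProjectiveDimensionLE_nilpotent_part (hιr : ι ≫ r = 𝟙 Z)
    (hι : ι ≫ endPow (i ≫ biprod.fst) n = 0) {N : ℕ}
    (hX : HasProjectiveDimensionLE X N) : HasProjectiveDimensionLE Z N := by
  let := HasExt.standard C
  rw [HasProjectiveDimensionLE, hasProjectiveDimensionLT_iff]
  rintro (_ | l) hl T z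
  · omega
  set f : E ⟶ E := i ≫ biprod.fst with hf
  have hsurj : ∀ y : Ext.{max w v} E T (l + 1), ∃ x, extPre f x = y := by
    intro y
    obtain ⟨x, hx⟩ := Ext.contravariant_sequence_exact₁ hS T y (add_comm 1 (l + 1))
      (Ext.eq_zero_of_hasProjectiveDimensionLT (X := X) _ (N + 1) (by omega))
    refine ⟨extPre biprod.inl x, ?_⟩
    rw [hf, extPre_comp, ← extPre_biprod_projective]
    exact hx
  have hsurj' : ∀ k, ∀ y : Ext.{max w v} E T (l + 1), ∃ x, extPre (endPow f k) x = y := by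
    intro k
    induction k with
    | zero => exact fun y => ⟨y, extPre_id y⟩
    | succ k ih =>
      intro y
      obtain ⟨x, rfl⟩ := ih y
      obtain ⟨x, rfl⟩ := hsurj x
      exact ⟨x, extPre_comp _ _ _⟩
  obtain ⟨x, hx⟩ := hsurj' n (extPre r z)
  calc z = extPre ι (extPre r z) := by rw [← extPre_comp, hιr, extPre_id]
    _ = 0 := by rw [← hx, ← extPre_comp, hι, extPre_zero_left]

/-- Write `f` for the component `E → E`. In degrees above `N` the complementary projection `q` acts
as the identity on the Ext groups of `E`. Since `q` factors through `f` on either side, `f` acts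
bijectively there. For a class on `X` of degree above `N + 1`, injectivity kills its pullback along
`p`, so it is the connecting image of some class on `E`. By surjectivity that class extends along
`i`, so its connecting image is zero. -/
theorem hasProjectiveDimensionLE_succ_of_nilpotent_part {q h : E ⟶ E} (hq : r ≫ ι + q = 𝟙 E)
    (h1 : h ≫ endPow (i ≫ biprod.fst) (n + 1) = q)
    (h2 : endPow (i ≫ biprod.fst) (n + 1) ≫ h = q) {N : ℕ}
    (hZ : HasProjectiveDimensionLE Z N) : HasProjectiveDimensionLE X (N + 1) := by
  let := HasExt.standard C
  rw [HasProjectiveDimensionLE, hasProjectiveDimensionLT_iff]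
  rintro (_ | _ | l) hl T x
  · omega
  · omega
  set f : E ⟶ E := i ≫ biprod.fst with hf
  have hqy : ∀ (l : ℕ), N ≤ l → ∀ y : Ext.{max w v} E T (l + 1), extPre q y = y := by
    intro l hl y
    have h0 : extPre (r ≫ ι + q) y = y := by rw [hq, extPre_id]
    rwa [extPre_add, extPre_comp,
      Ext.eq_zero_of_hasProjectiveDimensionLT (extPre ι y) (N + 1) (by omega),
      extPre_zero_right, zero_add] at h0
  have hsurj : ∀ y : Ext.{max w v} E T (l + 1), ∃ x, extPre f x = y := by
    intro y
    refine ⟨extPre (endPow f n) (extPre h y), ?_⟩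
    rw [← extPre_comp, ← extPre_comp]
    have : (f ≫ (endPow f n)) ≫ h = q := by rw [← h2, endPow_succ']
    rw [this]
    exact hqy l (by omega) y
  have hinj : ∀ y : Ext.{max w v} E T (l + 1 + 1), extPre f y = 0 → y = 0 := by
    intro y hy
    rw [← hqy (l + 1) (by omega) y, ← h1, extPre_comp, endPow, extPre_comp, hy, extPre_zero_right, extPre_zero_right]
  have hpx : extPre p x = 0 := by
    have h0 : extPre i (extPre p x) = 0 := by rw [← extPre_comp, w, extPre_zero_left]
    rw [extPre_biprod_projective (extPre p x), ← extPre_comp] at h0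
    rw [extPre_biprod_projective (extPre p x), hinj _ h0, extPre_zero_right]
  obtain ⟨y, rfl⟩ := Ext.contravariant_sequence_exact₃ hS T x hpx (add_comm 1 (l + 1))
  obtain ⟨y, rfl⟩ := hsurj y
  have : extPre f y = extPre i (extPre biprod.fst y) := by rw [hf, extPre_comp]
  rw [this]
  exact ShortComplex.ShortExact.extClass_comp_assoc hS _

end ExtCancellation

section Cancellation

variable {A : Type u} [Ring A]

theorem hom_endPow {E : ModuleCat.{u} A} (f : E ⟶ E) (n : ℕ) :
    (endPow f n).hom = f.hom ^ n := by
  induction n with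
  | zero => rfl
  | succ n ih =>
    rw [pow_succ', ← ih]
    rfl

variable [IsArtinianRing A]

/-- In a sequence `0 → E → E ⊕ P → X → 0` with `P` projective, the projective dimension of `X` is
controlled by a direct summand of `E` of finite projective dimension. -/
theorem exists_summand_controlling {E P X : ModuleCat.{u} A} (hE : fgMod A E) [Projective P]
    (hS : SES E (E ⊞ P) X) {N : ℕ} (hX : HasProjectiveDimensionLE X N) :
    ∃ Z : ModuleCat.{u} A, Nonempty (Retract Z E) ∧ HasProjectiveDimensionLE Z N ∧
      ∀ m, HasProjectiveDimensionLE Z m → HasProjectiveDimensionLE X (m + 1) := by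
  obtain ⟨i, p, w, hS⟩ := hS.exists_shortExact
  have : Module.Finite A E := hE
  have : IsNoetherian A E := isNoetherian_of_isNoetherianRing_of_finite A E
  have : IsArtinian A E := isArtinian_of_fg_of_artinian'
  obtain ⟨n, hn⟩ := Filter.eventually_atTop.mp
    (LinearMap.eventually_isCompl_ker_pow_range_pow (i ≫ biprod.fst).hom)
  -- One factor of the endomorphism has to be split off the power later, so the exponent must be
  -- positive.
  have hc := hn (n + 1) (Nat.le_succ n)
  have hfg : (endPow (i ≫ biprod.fst) (n + 1)).hom =
    (i ≫ biprod.fst).hom ^ (n + 1) := hom_endPow _ _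
  set g : E →ₗ[A] E := (i ≫ biprod.fst).hom ^ (n + 1) with hg
  let κ := LinearMap.ker g
  let ρ := LinearMap.range g
  have hbij : Function.Bijective (g.restrict (p := ρ) (q := ρ) fun x _ => ⟨x, rfl⟩) := by
    constructor
    · rw [injective_iff_map_eq_zero]
      rintro ⟨x, hx⟩ h0
      have h0 : g x = 0 := congrArg Subtype.val h0
      exact Subtype.ext (Submodule.disjoint_def.1 hc.disjoint x h0 hx)
    · rintro ⟨_, x, rfl⟩
      obtain ⟨y, hy, z, ⟨t, rfl⟩, hyz⟩ := Submodule.mem_sup.1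
        (hc.codisjoint.eq_top ▸ Submodule.mem_top : x ∈ LinearMap.ker g ⊔ LinearMap.range g)
      refine ⟨⟨g t, t, rfl⟩, Subtype.ext ?_⟩
      have hy : g y = 0 := hy
      show g (g t) = g x
      rw [← hyz, map_add, hy, zero_add]
  let b := LinearEquiv.ofBijective _ hbij
  have hb : ∀ y : ρ, (b y : E) = g y := fun y => rfl
  let π := Submodule.projectionOnto κ ρ hc
  let π' := Submodule.projectionOnto ρ κ hc.symm
  have hππ' : ∀ x, (π x : E) + π' x = x := fun x => by
    exact Submodule.projection_add_projection_eq_self hc x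
  have hgπ' : ∀ x, g (π' x) = g x := fun x => by
    have h0 : g (π x) = 0 := (π x).2
    conv_rhs => rw [← hππ' x, map_add, h0, zero_add]
  -- Inverts `g` on its range and vanishes on its kernel; both composites with `g` are the
  -- projection onto the range.
  let h : E →ₗ[A] E := ρ.subtype ∘ₗ b.symm.toLinearMap ∘ₗ π'
  have hgh : ∀ x, g (h x) = π' x := fun x => by
    show g (b.symm (π' x) : E) = _
    rw [← hb, b.apply_symm_apply]
  have hhg : ∀ x, h (g x) = π' x := fun x => by
    have h1 : π' (g x) = b (π' x) := by
      have : (⟨g x, x, rfl⟩ : ρ) = b (π' x) := Subtype.ext (by rw [hb, hgπ'])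
      rw [← this]
      exact Submodule.projectionOnto_apply_left hc.symm ⟨g x, x, rfl⟩
    show ((b.symm (π' (g x)) : ρ) : E) = _
    rw [h1, b.symm_apply_apply]
  let Z := ModuleCat.of A κ
  let ι : Z ⟶ E := ModuleCat.ofHom κ.subtype
  let r : E ⟶ Z := ModuleCat.ofHom π
  have hιr : ι ≫ r = 𝟙 Z :=
    ModuleCat.hom_ext (LinearMap.ext fun x => Submodule.projectionOnto_apply_left hc x)
  refine ⟨Z, ⟨⟨ι, r, hιr⟩⟩, ?_, fun m hm => ?_⟩
  · refine hasProjectiveDimensionLE_nilpotent_part hS (n := n + 1) hιr ?_ hX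
    refine ModuleCat.hom_ext (LinearMap.ext fun x => ?_)
    rw [ModuleCat.hom_comp, hfg]
    exact x.2
  · refine hasProjectiveDimensionLE_succ_of_nilpotent_part hS (n := n) (r := r) (ι := ι)
      (q := ModuleCat.ofHom (ρ.subtype ∘ₗ π')) (h := ModuleCat.ofHom h) ?_ ?_ ?_ hm
    · exact ModuleCat.hom_ext (LinearMap.ext fun x => hππ' x)
    · refine ModuleCat.hom_ext (LinearMap.ext fun x => ?_)
      rw [ModuleCat.hom_comp, hfg]
      exact hgh x
    · refine ModuleCat.hom_ext (LinearMap.ext fun x => ?_)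
      rw [ModuleCat.hom_comp, hfg]
      exact hhg x

end Cancellation

end GLIT

namespace GLIT

/-! ### Syzygies of short exact sequences -/

section SyzygySequences

variable {A : Type u} [Ring A]

/-- If `P` covers `X` and `Q` covers `Y`, then `P × Q` covers `Y` and `Q` covers `Z`. The covers
form a short exact sequence, hence so do their kernels. -/
theorem SES.exists_syz {X Y Z : ModuleCat.{u} A} (h : SES X Y Z) (hX : fgMod A X)
    (hY : fgMod A Y) :
    ∃ X' Y' Z' : ModuleCat.{u} A, IsSyz X' X ∧ IsSyz Y' Y ∧ IsSyz Z' Z ∧ SES X' Y' Z' := by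
  obtain ⟨i, p, hi, hp, hip⟩ := h
  have : Module.Finite A X := hX
  have : Module.Finite A Y := hY
  obtain ⟨n, a, ha⟩ := Module.Finite.exists_fin' A X
  obtain ⟨m, b, hb⟩ := Module.Finite.exists_fin' A Y
  let P := Fin n → A
  let Q := Fin m → A
  let c : P × Q →ₗ[A] Y := (i ∘ₗ a).coprod b
  have hc : Function.Surjective c := fun y => by
    obtain ⟨x, rfl⟩ := hb y
    exact ⟨(0, x), by simp [c]⟩
  refine ⟨ModuleCat.of A (LinearMap.ker a), ModuleCat.of A (LinearMap.ker c),
    ModuleCat.of A (LinearMap.ker (p ∘ₗ b)),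
    ⟨ModuleCat.of A P, inferInstanceAs (Module.Finite A (Fin n → A)),
      (projective_iff _).2 (inferInstanceAs (Module.Projective A (Fin n → A))),
      (LinearMap.ker a).subtype, a, Subtype.val_injective, ha, fun x => by simp⟩,
    ⟨ModuleCat.of A (P × Q), inferInstanceAs (Module.Finite A ((Fin n → A) × (Fin m → A))),
      (projective_iff _).2 (inferInstanceAs (Module.Projective A ((Fin n → A) × (Fin m → A)))),
      (LinearMap.ker c).subtype, c, Subtype.val_injective, hc, fun x => by simp⟩,
    ⟨ModuleCat.of A Q, inferInstanceAs (Module.Finite A (Fin m → A)),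
      (projective_iff _).2 (inferInstanceAs (Module.Projective A (Fin m → A))),
      (LinearMap.ker (p ∘ₗ b)).subtype, p ∘ₗ b, Subtype.val_injective, hp.comp hb,
      fun x => by simp⟩, ?_⟩
  have hpi : ∀ x, p (i x) = 0 := hip.apply_apply_eq_zero
  have hker : ∀ z : LinearMap.ker c, i (a z.1.1) + b z.1.2 = 0 := fun z => z.2
  let f : LinearMap.ker a →ₗ[A] LinearMap.ker c :=
    (LinearMap.inl A P Q ∘ₗ (LinearMap.ker a).subtype).codRestrict _ fun x => by
      have hx : a x = 0 := x.2
      simp [c, hx]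
  let g : LinearMap.ker c →ₗ[A] LinearMap.ker (p ∘ₗ b) :=
    (LinearMap.snd A P Q ∘ₗ (LinearMap.ker c).subtype).codRestrict _ fun z => by
      have := congrArg p (hker z)
      rw [map_add, hpi, zero_add, map_zero] at this
      exact this
  refine ⟨f, g, ?_, ?_, ?_⟩
  · intro x y hxy
    exact Subtype.ext (congrArg (fun z : LinearMap.ker c => z.1.1) hxy)
  · rintro ⟨z, hz⟩
    obtain ⟨x, hx⟩ := (hip (b z)).1 hz
    obtain ⟨y, rfl⟩ := ha x
    refine ⟨⟨(-y, z), ?_⟩, rfl⟩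
    show i (a (-y)) + b z = 0
    rw [map_neg, map_neg, hx, neg_add_cancel]
  · intro z
    constructor
    · intro h0
      have h0 : z.1.2 = 0 := congrArg Subtype.val h0
      have h1 := hker z
      rw [h0, map_zero, add_zero] at h1
      exact ⟨⟨z.1.1, hi (by rw [h1, map_zero])⟩, Subtype.ext (Prod.ext rfl h0.symm)⟩
    · rintro ⟨x, rfl⟩
      rfl

theorem SES.fg_right {X Y Z : ModuleCat.{u} A} (h : SES X Y Z) (hY : fgMod A Y) :
    fgMod A Z := by
  obtain ⟨_, g, _, hg, _⟩ := h
  have : Module.Finite A Y := hY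
  exact Module.Finite.of_surjective g hg

variable [IsArtinianRing A]

theorem SES.exists_iterated_syz {X Y Z : ModuleCat.{u} A} (h : SES X Y Z) (hX : fgMod A X)
    (hY : fgMod A Y) (m : ℕ) :
    ∃ X' Y' Z' : ModuleCat.{u} A, SES X' Y' Z' ∧ fgMod A X' ∧ fgMod A Y' ∧
      modClass X' = (syzygyMap A ^ m) (modClass X) ∧
      modClass Y' = (syzygyMap A ^ m) (modClass Y) ∧
      ∀ n, HasProjectiveDimensionLE Z (n + m) ↔ HasProjectiveDimensionLE Z' n := by
  induction m with
  | zero => exact ⟨X, Y, Z, h, hX, hY, rfl, rfl, fun n => Iff.rfl⟩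
  | succ m ih =>
    obtain ⟨X', Y', Z', h1, h2, h3, h4, h5, h6⟩ := ih
    obtain ⟨X'', Y'', Z'', g1, g2, g3, g4⟩ := h1.exists_syz h2 h3
    refine ⟨X'', Y'', Z'', g4, g1.fg, g2.fg, ?_, ?_, fun n => ?_⟩
    · rw [← syzygyMap_modClass h2 g1, h4, pow_succ', Module.End.mul_apply]
    · rw [← syzygyMap_modClass h3 g2, h5, pow_succ', Module.End.mul_apply]
    · rw [← g3.hasProjectiveDimensionLE_iff, ← h6, add_right_comm, add_assoc]

/-- After `j` syzygies the third term is projective, so the sequence splits and that term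
contributes class zero. -/
theorem SES.syzygyMap_pow_eq {X Y Z : ModuleCat.{u} A} (h : SES X Y Z) (hX : fgMod A X)
    (hY : fgMod A Y) {j : ℕ} (hZ : HasProjectiveDimensionLE Z j) :
    (syzygyMap A ^ j) (modClass X) = (syzygyMap A ^ j) (modClass Y) := by
  obtain ⟨X', Y', Z', h1, h2, h3, h4, h5, h6⟩ := h.exists_iterated_syz hX hY j
  have hp : Projective Z' := (projective_iff_hasProjectiveDimensionLE_zero Z').2
    ((h6 0).1 (by rwa [zero_add]))
  obtain ⟨e⟩ := h1.iso_of_projective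
  have hZ' := h1.fg_right h3
  rw [← h4, ← h5, modClass_congr h3 e, modClass_biprod h2 hZ', modClass_of_projective hZ' hp,
    add_zero]

end SyzygySequences

/-! ### The Igusa–Todorov bound -/

section Bound

variable {A : Type u} [Ring A]

/-- The span of the classes of the indecomposable non-projective modules in `D`. -/
noncomputable def classSpan (D : ObjectProperty (ModuleCat.{u} A)) : Submodule ℤ (KProj A) :=
  Finsupp.supported ℤ ℤ {q | ∃ Y : IndecNonProj A, D Y.1 ∧ _root_.Quotient.mk (isoSetoid A) Y = q}

/-- An element of the span has finite support, so the direct sum of finitely many members of `𝒟`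
accommodates it. This carries a bound on `Φ` of single modules over to the whole span. -/
theorem exists_mem_summandGroup {D : ObjectProperty (ModuleCat.{u} A)} (hD : addClosure D = D)
    {x : KProj A} (hx : x ∈ classSpan D) :
    ∃ X, D X ∧ x ∈ summandGroup X := by
  have hx' : ∀ q : x.support, ∃ Y : IndecNonProj A, D Y.1 ∧
    _root_.Quotient.mk (isoSetoid A) Y = q.1 := fun q => hx q.2
  choose Y hY hYq using hx'
  let l : List (ModuleCat.{u} A) := x.support.attach.toList.map fun q => (Y q).1
  have hl : ∀ Z ∈ l, D Z := by
    intro Z hZ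
    obtain ⟨q, _, rfl⟩ := List.mem_map.1 hZ
    exact hY q
  have hil : IndecList l := by
    intro Z hZ
    obtain ⟨q, _, rfl⟩ := List.mem_map.1 hZ
    exact ⟨(Y q).2.1, (Y q).2.2.1⟩
  refine ⟨sumList l, sumList_of_addClosure_eq hD l hl, ?_⟩
  have hmem : ∀ q : x.support, Finsupp.single q.1 (1 : ℤ) ∈ summandGroup (sumList l) := by
    intro q
    obtain ⟨l', _, e, _⟩ := exists_sumList_iso_of_mem hil (Z := (Y q).1)
      (List.mem_map.2 ⟨q, by simp, rfl⟩)
    refine Submodule.subset_span ⟨Y q, ⟨sumList l', e⟩, ?_⟩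
    rw [← hYq q]
    rfl
  have hx1 : x ∈ Finsupp.supported ℤ ℤ (x.support : Set _) := fun _ h => h
  rw [Finsupp.supported_eq_span_single] at hx1
  refine Submodule.span_le.2 ?_ hx1
  rintro _ ⟨q, hq, rfl⟩
  exact hmem ⟨q, hq⟩

theorem supported_support_fg (x : KProj A) :
    (Finsupp.supported ℤ ℤ (x.support : Set (_root_.Quotient (isoSetoid A)))).FG := by
  rw [Finsupp.supported_eq_span_single]
  exact Submodule.fg_span ((Finset.finite_toSet _).image _)

theorem mem_supported_of_le {x y : KProj A} (hx : 0 ≤ x) (hxy : x ≤ y)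
    {s : Set (_root_.Quotient (isoSetoid A))} (hy : y ∈ Finsupp.supported ℤ ℤ s) :
    x ∈ Finsupp.supported ℤ ℤ s := by
  intro q hq
  apply hy
  rw [Finset.mem_coe, Finsupp.mem_support_iff] at hq ⊢
  have h1 : (0 : ℤ) ≤ x q := hx q
  have h2 : x q ≤ y q := hxy q
  omega

variable [IsArtinianRing A]

theorem summandGroup_eq {X : ModuleCat.{u} A} (hX : fgMod A X) :
    summandGroup X = Submodule.span ℤ
      ((fun q => Finsupp.single q (1 : ℤ)) '' ((modClass X).support : Set _)) := by
  refine le_antisymm (Submodule.span_le.2 ?_) (Submodule.span_le.2 ?_)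
  · rintro _ ⟨Y, ⟨W, ⟨e⟩⟩, rfl⟩
    have hYW := fgMod_of_iso e hX
    refine Submodule.subset_span ⟨_, ?_, rfl⟩
    rw [modClass_congr hX e, modClass_biprod (fgMod_fst hYW) (fgMod_snd hYW), modClass_basis]
    have h1 : (0 : ℤ) ≤ modClass W (_root_.Quotient.mk (isoSetoid A) Y) :=
      modClass_nonneg (fgMod_snd hYW) _
    have h2 : basisClass Y (_root_.Quotient.mk (isoSetoid A) Y) = 1 := Finsupp.single_eq_same
    rw [Finset.mem_coe, Finsupp.mem_support_iff, Finsupp.add_apply, h2]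
    omega
  · rintro _ ⟨q, hq, rfl⟩
    obtain ⟨Y, rfl, W, hW⟩ := exists_summand_of_modClass_ne_zero hX (Finsupp.mem_support_iff.1 hq)
    exact Submodule.subset_span ⟨Y, ⟨W, hW⟩, rfl⟩

theorem summandGroup_eq_supported {X : ModuleCat.{u} A} (hX : fgMod A X) :
    summandGroup X = Finsupp.supported ℤ ℤ ((modClass X).support : Set _) := by
  rw [summandGroup_eq hX, Finsupp.supported_eq_span_single]

theorem summandGroup_fg {X : ModuleCat.{u} A} (hX : fgMod A X) : (summandGroup X).FG := by
  rw [summandGroup_eq_supported hX]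
  exact supported_support_fg _

theorem syzygyMap_pow_eq_zero_of_phi_le {X : ModuleCat.{u} A} (hX : fgMod A X) {d : ℕ}
    (hd : Phi X ≤ d) {x : KProj A} (hx : x ∈ summandGroup X) {j : ℕ}
    (hj : (syzygyMap A ^ j) x = 0) : (syzygyMap A ^ d) x = 0 := by
  -- The infimum defining `Phi` is attained because the set is nonempty: the ranks decrease and so
  -- stabilise.
  have hmem : Phi X ∈ {n : ℕ | ∀ k, n ≤ k → syzygyRank k X = syzygyRank (k + 1) X} :=
    Nat.sInf_mem (exists_finrank_map_pow_eq (syzygyMap A) _ (summandGroup_fg hX))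
  exact pow_apply_eq_zero_of_le _ hd
    (pow_apply_eq_zero_of_finrank_eq (syzygyMap A) _ (summandGroup_fg hX) _ hmem hx j hj)

theorem modClass_mem_classSpan {D : ObjectProperty (ModuleCat.{u} A)} (hD : addClosure D = D)
    {X : ModuleCat.{u} A} (hX : fgMod A X) (h : D X) : modClass X ∈ classSpan D := by
  intro q hq
  obtain ⟨Y, rfl, W, ⟨e⟩⟩ := exists_summand_of_modClass_ne_zero hX (Finsupp.mem_support_iff.1 hq)
  exact ⟨Y, summand_of_addClosure_eq hD h e, rfl⟩

theorem modClass_le_of_iso_biprod {X Y W : ModuleCat.{u} A} (hX : fgMod A X) (e : X ≅ Y ⊞ W) :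
    modClass Y ≤ modClass X := by
  have h := fgMod_of_iso e hX
  rw [modClass_congr hX e, modClass_biprod (fgMod_fst h) (fgMod_snd h)]
  exact le_add_of_nonneg_right (modClass_nonneg (fgMod_snd h))

theorem addClosure_singleton {V X : ModuleCat.{u} A} (hV : fgMod A V)
    (hX : addClosure (fun Y => Y = V) X) :
    fgMod A X ∧ ∃ n : ℕ, modClass X ≤ n • modClass V := by
  obtain ⟨n, Y, W, hY, ⟨e⟩⟩ := hX
  obtain rfl : Y = fun _ => V := funext hY
  have hl : ∀ Z ∈ List.ofFn (fun _ : Fin n => V), Z = V := fun Z hZ => by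
    obtain ⟨i, rfl⟩ := (List.mem_ofFn' _ _).1 hZ
    rfl
  obtain ⟨h1, h2⟩ := modClass_sumList fun Z hZ => (hl Z hZ).symm ▸ hV
  have e' := (biproductIsoSumList fun _ : Fin n => V).symm ≪≫ e
  refine ⟨fgMod_fst (fgMod_of_iso e' h1), n, ?_⟩
  refine (modClass_le_of_iso_biprod h1 e').trans (le_of_eq ?_)
  rw [h2, List.map_ofFn, List.sum_ofFn]
  simp

theorem exists_bound_classSpan {D : ObjectProperty (ModuleCat.{u} A)} (hD : addClosure D = D)
    (hfg : ∀ X, D X → fgMod A X) {d : ℕ} (hd : ∀ X, D X → Phi X ≤ d) (v : KProj A) :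
    ∃ m, ∀ x ∈ Finsupp.supported ℤ ℤ (v.support : Set _) ⊔ classSpan D, ∀ j,
      (syzygyMap A ^ j) x = 0 → (syzygyMap A ^ m) x = 0 := by
  refine exists_uniform_nilpotency (syzygyMap A) _ _ (supported_support_fg v) d fun x hx j hj => ?_
  obtain ⟨X, hX, hxX⟩ := exists_mem_summandGroup hD hx
  exact syzygyMap_pow_eq_zero_of_phi_le (hfg X hX) (hd X hX) hxX hj

/-- Equal classes give `X ⊞ P ≅ Y ⊞ Q` with `P`, `Q` projective. Adding the trivial sequences `0 → Q
→ Q` and `P → P → 0` produces `E → E ⊞ P → Z ⊞ Q` with `E = X ⊞ P`, to which the Fitting argument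
applies. -/
theorem SES.exists_stabilized {X Y Z : ModuleCat.{u} A} (h : SES X Y Z) (hX : fgMod A X)
    (hY : fgMod A Y) (heq : modClass X = modClass Y) {N : ℕ} (hZ : HasProjectiveDimensionLE Z N) :
    ∃ W : ModuleCat.{u} A, fgMod A W ∧ modClass W ≤ modClass X ∧ HasProjectiveDimensionLE W N ∧
      ∀ m, HasProjectiveDimensionLE W m → HasProjectiveDimensionLE Z (m + 1) := by
  obtain ⟨P, Q, hPf, hP, hQf, hQ, ⟨e⟩⟩ := exists_stable_iso_of_modClass_eq hX hY heq
  let O : ModuleCat.{u} A := ModuleCat.of A PUnit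
  have hO : IsZero O := ModuleCat.isZero_of_subsingleton _
  have hPO : SES P P O := ⟨LinearMap.id, 0, Function.injective_id,
    fun _ => ⟨0, Subsingleton.elim _ _⟩, fun x => by simp⟩
  have hE : SES (X ⊞ P) ((X ⊞ P) ⊞ P) (Z ⊞ Q) :=
    (((h.prod (SES.zero_left Q)).congr (biprodZeroIso hO) (Iso.refl _) (Iso.refl _)).prod
      hPO).congr (Iso.refl _) (biprod.mapIso e.symm (Iso.refl P)) (biprodZeroIso hO)
  have hEf := fgMod_prod hX hPf
  have hQ' : HasProjectiveDimensionLE Q N := hasProjectiveDimensionLE_of_le (Nat.zero_le N)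
    ((projective_iff_hasProjectiveDimensionLE_zero Q).1 hQ)
  have hZQ : HasProjectiveDimensionLE (Z ⊞ Q) N := inferInstance
  obtain ⟨W, ⟨r⟩, h1, h2⟩ := exists_summand_controlling hEf hE hZQ
  refine ⟨W, fgMod_of_retract r hEf, ?_, h1, fun m hm => ?_⟩
  · obtain ⟨R, f, _⟩ := exists_iso_biprod_of_retract r.i r.r r.retract
    have := modClass_le_of_iso_biprod hEf f
    rwa [modClass_biprod hX hPf, modClass_of_projective hPf hP, add_zero] at this
  · have := h2 m hm
    exact Retract.hasProjectiveDimensionLT (Y := Z ⊞ Q) ⟨biprod.inl, biprod.fst, by simp⟩ _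

/-- The Igusa–Todorov argument: a special GLIT algebra has finite finitistic dimension. -/
theorem finDim_ne_top_of_isSpecialGLIT (h : IsSpecialGLIT A) : finDim A ≠ ⊤ := by
  obtain ⟨t, V, D, h⟩ := h
  obtain ⟨d, hd⟩ := h.D_phiDim
  obtain ⟨m₀, hm₀⟩ := exists_bound_classSpan h.D_add h.D_fg hd (modClass V)
  -- A multiple of `t`, so that `Ω^m` preserves `𝒟`.
  set m := t * m₀ with hm
  -- A second uniform bound, now with the class of `Ω^m V` in place of that of `V`: the controlling
  -- summand is found after `m` syzygies.
  obtain ⟨m₁, hm₁⟩ := exists_bound_classSpan h.D_add h.D_fg hd ((syzygyMap A ^ m) (modClass V))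
  rw [finDim_ne_top_iff]
  refine ⟨m₁ + 1 + m, fun X hX hk => ?_⟩
  obtain ⟨V₁, D₁, V₀, D₀, hV₁, hD₁, hV₀, hD₀, i, p, w, hS⟩ :=
    h.exact_seq X ⟨hX, (projectiveDimension_ne_top_iff X).2 hk⟩
  obtain ⟨j, hj⟩ := hk
  obtain ⟨hV₁f, n₁, hn₁⟩ := addClosure_singleton h.V_fg hV₁
  obtain ⟨hV₀f, n₀, hn₀⟩ := addClosure_singleton h.V_fg hV₀
  have hD₁f := h.D_fg _ hD₁
  have hD₀f := h.D_fg _ hD₀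
  have hS : SES (V₁ ⊞ D₁) (V₀ ⊞ D₀) X := ses_of_shortExact hS
  have h1f := fgMod_prod hV₁f hD₁f
  have h0f := fgMod_prod hV₀f hD₀f
  have hmem : ∀ {V' D' : ModuleCat.{u} A} {n : ℕ}, fgMod A V' → D D' →
      modClass V' ≤ n • modClass V → modClass (V' ⊞ D') ∈
        Finsupp.supported ℤ ℤ ((modClass V).support : Set _) ⊔ classSpan D := by
    intro V' D' n hV' hD' hn
    rw [modClass_biprod hV' (h.D_fg _ hD')]
    exact Submodule.add_mem_sup
      (mem_supported_of_le (modClass_nonneg hV') hn (Submodule.smul_of_tower_mem _ n fun _ h => h))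
      (modClass_mem_classSpan h.D_add (h.D_fg _ hD') hD')
  have heq : (syzygyMap A ^ m) (modClass (V₁ ⊞ D₁)) = (syzygyMap A ^ m) (modClass (V₀ ⊞ D₀)) := by
    rw [← sub_eq_zero, ← map_sub]
    -- The exponent `j` depends on `X`, but uniform nilpotency replaces it by `m₀ ≤ m`.
    refine pow_apply_eq_zero_of_le _ (Nat.le_mul_of_pos_left m₀ h.one_le)
      (hm₀ _ (Submodule.sub_mem _ (hmem hV₁f hD₁ hn₁) (hmem hV₀f hD₀ hn₀)) j ?_)
    rw [map_sub, hS.syzygyMap_pow_eq h1f h0f hj, sub_self]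
  obtain ⟨X', Y', Z', hS', hX', hY', e1, e2, e3⟩ := hS.exists_iterated_syz h1f h0f m
  have hZ' : HasProjectiveDimensionLE Z' j :=
    (e3 j).1 (hasProjectiveDimensionLE_of_le (Nat.le_add_right j m) hj)
  obtain ⟨W, hW, hWle, hWj, hWm⟩ := hS'.exists_stabilized hX' hY' (by rw [e1, e2, heq]) hZ'
  refine (e3 _).2 (hWm _ ?_)
  rw [hasProjectiveDimensionLE_iff_syzygyMap hW] at hWj ⊢
  refine hm₁ _ ?_ j hWj
  have hDm : D (syzygy^[m] D₁) := by
    rw [hm, Function.iterate_mul]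
    exact Function.Iterate.rec D hD₁ h.D_syzygy m₀
  -- `W` is, up to projectives, a summand of the `m`-th syzygy of `V₁ ⊞ D₁`. By positivity its class
  -- is supported where the classes of `Ω^m V` and `Ω^m D₁` are.
  have hle : modClass W ≤ n₁ • (syzygyMap A ^ m) (modClass V) + modClass (syzygy^[m] D₁) := by
    rw [modClass_syzygy_iterate hD₁f, ← map_nsmul]
    refine hWle.trans ?_
    rw [e1, modClass_biprod hV₁f hD₁f, map_add]
    exact add_le_add_left (syzygyMap_pow_mono hn₁ m) _
  rw [classSpan, ← Finsupp.supported_union]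
  refine mem_supported_of_le (modClass_nonneg hW) hle ?_
  rw [Finsupp.supported_union]
  exact Submodule.add_mem_sup (Submodule.smul_of_tower_mem _ n₁ fun _ h => h)
    (modClass_mem_classSpan h.D_add (h.D_fg _ hDm) hDm)

theorem isSpecialGLIT_iff_finDim_ne_top : IsSpecialGLIT A ↔ finDim A ≠ ⊤ :=
  ⟨finDim_ne_top_of_isSpecialGLIT, isSpecialGLIT_of_finDim_ne_top⟩

end Bound

end GLIT

namespace GLIT

/-! ### Projective dimension under restriction of scalars -/

section Restriction

variable {R S : Type u} [Ring R] [Ring S] (f : R →+* S)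

/-- Restriction of scalars. -/
noncomputable abbrev res (X : ModuleCat.{u} S) : ModuleCat.{u} R :=
  (ModuleCat.restrictScalars f).obj X

/-- A linear map seen as a linear map between restrictions of scalars. -/
noncomputable def resMap {X Y : ModuleCat.{u} S} (g : X →ₗ[S] Y) : res f X →ₗ[R] res f Y :=
  ((ModuleCat.restrictScalars f).map (ModuleCat.ofHom g)).hom

theorem resMap_apply {X Y : ModuleCat.{u} S} (g : X →ₗ[S] Y) (x : X) : resMap f g x = g x := rfl

theorem SES.res {X Y Z : ModuleCat.{u} S} (h : SES X Y Z) :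
    SES (res f X) (res f Y) (res f Z) := by
  obtain ⟨i, p, hi, hp, hip⟩ := h
  exact ⟨resMap f i, resMap f p, hi, hp, hip⟩

theorem exists_ses_projective (X : ModuleCat.{u} S) :
    ∃ K F : ModuleCat.{u} S, Projective F ∧ SES K F X :=
  ⟨_, _, inferInstanceAs (Projective X.projectiveShortComplex.X₂),
    ses_of_shortExact X.shortExact_projectiveShortComplex⟩

theorem SES.hasProjectiveDimensionLE_iff {X Y Z : ModuleCat.{u} S} (h : SES X Y Z)
    (hY : Projective Y) (n : ℕ) :
    HasProjectiveDimensionLE Z (n + 1) ↔ HasProjectiveDimensionLE X n := by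
  obtain ⟨i, p, w, hS⟩ := h.exists_shortExact
  exact hS.hasProjectiveDimensionLT_X₃_iff n hY

theorem projective_res [Module R S] (hRS : ∀ (r : R) (s : S), r • s = f r * s)
    [Module.Projective R S] (X : ModuleCat.{u} S) (hX : Projective X) : Projective (res f X) := by
  rw [projective_iff] at hX ⊢
  obtain ⟨s, hs⟩ := Module.projective_def'.1 hX
  let i : res f X →ₗ[R] (X →₀ S) :=
    { toFun := fun x => s x
      map_add' := fun x y => s.map_add x y
      map_smul' := fun r x => by
        refine (s.map_smul (f r) x).trans (Finsupp.ext fun y => ?_)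
        exact (hRS r (s x y)).symm }
  let p : (X →₀ S) →ₗ[R] res f X :=
    { toFun := fun x => Finsupp.linearCombination S id x
      map_add' := fun x y => map_add (Finsupp.linearCombination S (id : X → X)) x y
      map_smul' := fun r x => by
        have h : r • x = f r • x := Finsupp.ext fun y => hRS r (x y)
        rw [h]
        exact map_smul (Finsupp.linearCombination S (id : X → X)) (f r) x }
  classical
  have : Module.Projective R (X →₀ S) :=
    Module.Projective.of_equiv (finsuppLequivDFinsupp (ι := X) (M := S) R).symm
  exact Module.Projective.of_split i p (LinearMap.ext fun x => LinearMap.congr_fun hs x)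

theorem hasProjectiveDimensionLE_res [Module R S] (hRS : ∀ (r : R) (s : S), r • s = f r * s)
    [Module.Projective R S] (n : ℕ) (X : ModuleCat.{u} S) (hX : HasProjectiveDimensionLE X n) :
    HasProjectiveDimensionLE (res f X) n := by
  induction n generalizing X with
  | zero =>
    rw [← projective_iff_hasProjectiveDimensionLE_zero] at hX ⊢
    exact projective_res f hRS X hX
  | succ n ih =>
    obtain ⟨K, F, hF, h⟩ := exists_ses_projective X
    exact ((h.res f).hasProjectiveDimensionLE_iff (projective_res f hRS F hF) n).2
      (ih K ((h.hasProjectiveDimensionLE_iff hF n).1 hX))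

theorem fg_res [Module R S] (hRS : ∀ (r : R) (s : S), r • s = f r * s) [Module.Finite R S]
    {X : ModuleCat.{u} S} (hX : fgMod S X) : fgMod R (res f X) := by
  have : Module.Finite S X := hX
  obtain ⟨n, p, hp⟩ := Module.Finite.exists_fin' S X
  let q : (Fin n → S) →ₗ[R] res f X :=
    { toFun := fun x => p x
      map_add' := fun x y => map_add p x y
      map_smul' := fun r x => by
        have h : r • x = f r • x := funext fun y => hRS r (x y)
        rw [h]
        exact map_smul p (f r) x }
  exact Module.Finite.of_surjective q hp

theorem fg_of_res (hf : Function.Surjective f) {X : ModuleCat.{u} S} (hX : fgMod R (res f X)) :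
    fgMod S X := by
  have : RingHomSurjective f := ⟨hf⟩
  have : Module.Finite R (res f X) := hX
  let q : res f X →ₛₗ[f] X :=
    { toFun := fun x => x
      map_add' := fun _ _ => rfl
      map_smul' := fun _ _ => rfl }
  exact Module.Finite.of_surjective q Function.surjective_id

/-- Along a surjection of rings an `R`-linear splitting of an `S`-linear map is automatically
`S`-linear. -/
theorem projective_of_res (hf : Function.Surjective f) {X : ModuleCat.{u} S}
    (hX : Projective (res f X)) : Projective X := by
  rw [projective_iff] at hX ⊢
  let p : ModuleCat.of S (X →₀ S) →ₗ[S] X := Finsupp.linearCombination S id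
  have hp : Function.Surjective p := Finsupp.linearCombination_id_surjective S X
  obtain ⟨s, hs⟩ := Module.projective_lifting_property (resMap f p) LinearMap.id hp
  let i : X →ₗ[S] (X →₀ S) :=
    { toFun := fun x => s x
      map_add' := fun x y => s.map_add x y
      map_smul' := fun a x => by
        obtain ⟨r, rfl⟩ := hf a
        exact s.map_smul r x }
  exact Module.Projective.of_split i p (LinearMap.ext fun x => LinearMap.congr_fun hs x)

theorem hasProjectiveDimensionLE_of_res (hf : Function.Surjective f) [Module R S]
    (hRS : ∀ (r : R) (s : S), r • s = f r * s) [Module.Projective R S] (n : ℕ)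
    (X : ModuleCat.{u} S) (hX : HasProjectiveDimensionLE (res f X) n) :
    HasProjectiveDimensionLE X n := by
  induction n generalizing X with
  | zero =>
    rw [← projective_iff_hasProjectiveDimensionLE_zero] at hX ⊢
    exact projective_of_res f hf hX
  | succ n ih =>
    obtain ⟨K, F, hF, h⟩ := exists_ses_projective X
    exact (h.hasProjectiveDimensionLE_iff hF n).2 (ih K
      (((h.res f).hasProjectiveDimensionLE_iff (projective_res f hRS F hF) n).1 hX))

end Restriction

/-! ### Direct factors of a ring -/

section ProductRing

variable {R S : Type u} [Ring R] [Ring S]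

/-- `S` is a direct factor of the ring `R`, with projection `f` and non-unital inclusion `σ`. -/
structure IsDirectFactor (f : R →+* S) (σ : S → R) : Prop where
  add : ∀ a b, σ (a + b) = σ a + σ b
  mul : ∀ a b, σ (a * b) = σ a * σ b
  section_apply : ∀ a, f (σ a) = a
  left : ∀ r, σ (f r) = r * σ 1
  right : ∀ r, σ (f r) = σ 1 * r

variable {f : R →+* S} {σ : S → R} (h : IsDirectFactor f σ)

include h

theorem IsDirectFactor.surjective : Function.Surjective f := fun a => ⟨σ a, h.section_apply a⟩

theorem IsDirectFactor.smul (r : R) (a : S) : σ (f r * a) = r * σ a := by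
  rw [h.mul, h.left, mul_assoc, ← h.mul, one_mul]

theorem IsDirectFactor.projective [Module R S] (hRS : ∀ (r : R) (s : S), r • s = f r * s) :
    Module.Projective R S :=
  Module.Projective.of_split (M := R)
    { toFun := σ
      map_add' := h.add
      map_smul' := fun r a => by rw [hRS, h.smul]; rfl }
    { toFun := f
      map_add' := map_add f
      map_smul' := fun r a => by rw [hRS, smul_eq_mul, map_mul]; rfl }
    (LinearMap.ext fun a => h.section_apply a)

theorem IsDirectFactor.finite [Module R S] (hRS : ∀ (r : R) (s : S), r • s = f r * s) :
    Module.Finite R S :=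
  Module.Finite.of_surjective (M := R)
    { toFun := f
      map_add' := map_add f
      map_smul' := fun r a => by rw [RingHom.id_apply, hRS, smul_eq_mul, map_mul] } h.surjective

theorem IsDirectFactor.finDim_le : finDim S ≤ finDim R := by
  by_cases ht : finDim R = ⊤
  · rw [ht]; exact le_top
  obtain ⟨n, hn⟩ := ENat.ne_top_iff_exists.1 ht
  rw [← hn, finDim_le_iff]
  have hn' := (finDim_le_iff n).1 hn.symm.le
  intro X hX ⟨k, hk⟩
  let : Module R S := Module.compHom S f
  have hRS : ∀ (r : R) (s : S), r • s = f r * s := fun _ _ => rfl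
  have := h.projective hRS
  have := h.finite hRS
  exact hasProjectiveDimensionLE_of_res f h.surjective hRS n X
    (hn' _ (fg_res f hRS hX) ⟨k, hasProjectiveDimensionLE_res f hRS k X hk⟩)

/-- The part of a module on which a direct factor of the ring acts. -/
theorem IsDirectFactor.exists_corner (Z : ModuleCat.{u} R) :
    ∃ (X : ModuleCat.{u} S) (i : res f X →ₗ[R] Z) (p : Z →ₗ[R] res f X),
      (∀ x, p (i x) = x) ∧ ∀ z, i (p z) = σ 1 • z := by
  have hc : ∀ r, r * σ 1 = σ 1 * r := fun r => (h.left r).symm.trans (h.right r)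
  have h11 : σ 1 * σ 1 = σ 1 := by rw [← h.mul, one_mul]
  have h0 : σ 0 = 0 := by simpa using h.add 0 0
  let E : AddSubgroup Z :=
    { carrier := {z | σ 1 • z = z}
      add_mem' := fun {a b} ha hb => by
        have ha : σ 1 • a = a := ha
        have hb : σ 1 • b = b := hb
        show σ 1 • (a + b) = a + b
        rw [smul_add, ha, hb]
      zero_mem' := smul_zero _
      neg_mem' := fun {a} ha => by
        have ha : σ 1 • a = a := ha
        show σ 1 • (-a) = -a
        rw [smul_neg, ha] }
  have hmem : ∀ a (z : E), σ a • z.1 ∈ E := fun a z => by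
    show σ 1 • σ a • z.1 = σ a • z.1
    rw [← mul_smul, ← h.mul, one_mul]
  let : Module S E :=
    { smul := fun a z => ⟨σ a • z.1, hmem a z⟩
      one_smul := fun z => Subtype.ext z.2
      mul_smul := fun a b z => Subtype.ext (by
        show σ (a * b) • z.1 = σ a • σ b • z.1
        rw [h.mul, mul_smul])
      smul_zero := fun a => Subtype.ext (smul_zero (σ a))
      smul_add := fun a y z => Subtype.ext (smul_add (σ a) y.1 z.1)
      add_smul := fun a b z => Subtype.ext (by
        show σ (a + b) • z.1 = σ a • z.1 + σ b • z.1
        rw [h.add, add_smul])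
      zero_smul := fun z => Subtype.ext (by
        show σ 0 • z.1 = 0
        rw [h0, zero_smul]) }
  have hs : ∀ (r : R) (z : E), ((f r • z : E) : Z) = r • z.1 := fun r z => by
    have hz : σ 1 • z.1 = z.1 := z.2
    show σ (f r) • z.1 = r • z.1
    rw [h.left, mul_smul, hz]
  refine ⟨ModuleCat.of S E,
    { toFun := fun x => (show E from x).1
      map_add' := fun _ _ => rfl
      map_smul' := fun r x => hs r x },
    { toFun := fun z => (⟨σ 1 • z, by
        show σ 1 • σ 1 • z = σ 1 • z
        rw [← mul_smul, h11]⟩ : E)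
      map_add' := fun y z => Subtype.ext (smul_add (σ 1) y z)
      map_smul' := fun r z => Subtype.ext (by
        refine Eq.trans ?_ (hs r _).symm
        show σ 1 • r • z = r • σ 1 • z
        rw [← mul_smul, ← mul_smul, hc]) }, fun x => Subtype.ext (show E from x).2, fun z => rfl⟩

theorem IsDirectFactor.hasProjectiveDimensionLE_corner {n : ℕ} (hn : finDim S ≤ n)
    {Z : ModuleCat.{u} R} (hZ : fgMod R Z) {k : ℕ} (hk : HasProjectiveDimensionLE Z k)
    {X : ModuleCat.{u} S} (i : res f X →ₗ[R] Z) (p : Z →ₗ[R] res f X) (hip : ∀ x, p (i x) = x) :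
    HasProjectiveDimensionLE (res f X) n := by
  let : Module R S := Module.compHom S f
  have hRS : ∀ (r : R) (s : S), r • s = f r * s := fun _ _ => rfl
  have := h.projective hRS
  let r : Retract (res f X) Z :=
    ⟨ModuleCat.ofHom (X := res f X) i, ModuleCat.ofHom (Y := res f X) p, ModuleCat.hom_ext (LinearMap.ext hip)⟩
  have hk' : HasProjectiveDimensionLE (res f X) k := r.hasProjectiveDimensionLT (k + 1)
  exact hasProjectiveDimensionLE_res f hRS n X ((finDim_le_iff n).1 hn X
    (fg_of_res f h.surjective (fgMod_of_retract r hZ))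
    ⟨k, hasProjectiveDimensionLE_of_res f h.surjective hRS k X hk'⟩)

end ProductRing

/-! ### Finitistic dimension of a product ring -/

section FinDimProd

theorem isDirectFactor_fst (T U : Type u) [Ring T] [Ring U] :
    IsDirectFactor (RingHom.fst T U) (fun t => (t, 0)) where
  add a b := by simp
  mul a b := by simp
  section_apply a := rfl
  left r := by ext <;> simp
  right r := by ext <;> simp

theorem isDirectFactor_snd (T U : Type u) [Ring T] [Ring U] :
    IsDirectFactor (RingHom.snd T U) (fun u => (0, u)) where
  add a b := by simp
  mul a b := by simp
  section_apply a := rfl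
  left r := by ext <;> simp
  right r := by ext <;> simp

/-- As `1 = (1, 0) + (0, 1)` with central idempotents, a module is the sum of its two corners, each
of which is bounded over its own factor. -/
theorem finDim_prod (T U : Type u) [Ring T] [Ring U] :
    finDim (T × U) = max (finDim T) (finDim U) := by
  have hT := isDirectFactor_fst T U
  have hU := isDirectFactor_snd T U
  refine le_antisymm ?_ (max_le hT.finDim_le hU.finDim_le)
  by_cases ht : max (finDim T) (finDim U) = ⊤
  · rw [ht]; exact le_top
  obtain ⟨n, hn⟩ := ENat.ne_top_iff_exists.1 ht
  obtain ⟨hnT, hnU⟩ := max_le_iff.1 hn.symm.le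
  rw [← hn, finDim_le_iff]
  intro Z hZ ⟨k, hk⟩
  obtain ⟨X, i, p, hip, hpi⟩ := hT.exists_corner Z
  obtain ⟨Y, i', p', hip', hpi'⟩ := hU.exists_corner Z
  have hX := hT.hasProjectiveDimensionLE_corner hnT hZ hk i p hip
  have hY := hU.hasProjectiveDimensionLE_corner hnU hZ hk i' p' hip'
  have hXY : HasProjectiveDimensionLE (res (RingHom.fst T U) X ⊞ res (RingHom.snd T U) Y) n :=
    inferInstance
  have hsum : ∀ z : Z, i (p z) + i' (p' z) = z := fun z => by
    rw [hpi, hpi', ← add_smul]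
    have h1 : ((1, 0) + (0, 1) : T × U) = 1 := by ext <;> simp
    rw [h1, one_smul]
  exact Retract.hasProjectiveDimensionLT (Y := res (RingHom.fst T U) X ⊞ res (RingHom.snd T U) Y)
    ⟨biprod.lift (ModuleCat.ofHom (Y := res (RingHom.fst T U) X) p)
        (ModuleCat.ofHom (Y := res (RingHom.snd T U) Y) p'),
      biprod.desc (ModuleCat.ofHom (X := res (RingHom.fst T U) X) i)
        (ModuleCat.ofHom (X := res (RingHom.snd T U) Y) i'), by
        refine biprod.lift_desc.trans ?_
        exact ModuleCat.hom_ext (LinearMap.ext hsum)⟩ (n + 1)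

end FinDimProd

end GLIT

namespace GLIT

open scoped TensorProduct

/-! ### Tensor products with bimodules over noncommutative rings -/

section BimoduleTensor

variable {R S B : Type u} [Ring R] [Ring S] [AddCommGroup B] [Module S B] (act : R → B →ₗ[S] B)
  (X : Type u) [AddCommGroup X] [Module R X]

/-- The relations `b r ⊗ x = b ⊗ r x`, where the right action of `R` on the left `S`-module `B` is
given by `act`. -/
def bimoduleRel : Submodule S (B ⊗[ℤ] X) :=
  Submodule.span S {w | ∃ (b : B) (r : R) (x : X), w = act r b ⊗ₜ x - b ⊗ₜ (r • x)}

/-- The tensor product of a bimodule and a left module over a noncommutative ring, as a left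
module. -/
abbrev BimoduleTensor : Type u := (B ⊗[ℤ] X) ⧸ bimoduleRel act X

variable {X}

/-- Pure tensors. -/
def bmk (b : B) (x : X) : BimoduleTensor act X := Submodule.Quotient.mk (b ⊗ₜ x)

theorem bmk_add (b : B) (x y : X) : bmk act b (x + y) = bmk act b x + bmk act b y := by
  rw [bmk, TensorProduct.tmul_add]; rfl

theorem add_bmk (b c : B) (x : X) : bmk act (b + c) x = bmk act b x + bmk act c x := by
  rw [bmk, TensorProduct.add_tmul]; rfl

theorem smul_bmk (s : S) (b : B) (x : X) : s • bmk act b x = bmk act (s • b) x := rfl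

theorem act_bmk (b : B) (r : R) (x : X) : bmk act (act r b) x = bmk act b (r • x) := by
  rw [← sub_eq_zero]
  exact (Submodule.Quotient.mk_eq_zero _).2 (Submodule.subset_span ⟨b, r, x, rfl⟩)

/-- Pure tensors as a biadditive map. -/
def bmkHom : B →+ X →+ BimoduleTensor act X :=
  AddMonoidHom.mk' (fun b => AddMonoidHom.mk' (bmk act b) (bmk_add act b))
    fun b c => AddMonoidHom.ext fun x => add_bmk act b c x

theorem bmkHom_apply (b : B) (x : X) : bmkHom act b x = bmk act b x := rfl

theorem bmk_induction {p : BimoduleTensor act X → Prop} (h0 : p 0) (h1 : ∀ b x, p (bmk act b x))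
    (h2 : ∀ v w, p v → p w → p (v + w)) (w : BimoduleTensor act X) : p w := by
  obtain ⟨w, rfl⟩ := Submodule.Quotient.mk_surjective _ w
  induction w with
  | zero => exact h0
  | tmul b x => exact h1 b x
  | add v w hv hw => exact h2 _ _ hv hw

variable {G : Type u} [AddCommGroup G]

/-- Balanced biadditive maps factor through the tensor product. -/
def bmkLift (φ : B →+ X →+ G) (h : ∀ r b x, φ (act r b) x = φ b (r • x)) :
    BimoduleTensor act X →+ G :=
  QuotientAddGroup.lift (bimoduleRel act X).toAddSubgroup
    (TensorProduct.liftAddHom φ fun n b x => by simp) (by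
      intro w hw
      -- The relations form an `S`-submodule while `φ` is only additive, so vanishing is proved for
      -- all `S`-multiples at once.
      suffices ∀ s : S, TensorProduct.liftAddHom φ (fun n b x => by simp) (s • w) = 0 by
        simpa using this 1
      replace hw : w ∈ bimoduleRel act X := hw
      induction hw using Submodule.span_induction with
      | mem w hw =>
        obtain ⟨b, r, x, rfl⟩ := hw
        intro s
        rw [smul_sub, TensorProduct.smul_tmul', TensorProduct.smul_tmul', map_sub,
          TensorProduct.liftAddHom_tmul, TensorProduct.liftAddHom_tmul, ← map_smul, h, sub_self]
      | zero => intro s; rw [smul_zero, map_zero]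
      | add v w _ _ hv hw => intro s; rw [smul_add, map_add, hv, hw, add_zero]
      | smul a w _ hw => intro s; rw [← mul_smul, hw])

theorem bmkLift_bmk (φ : B →+ X →+ G) (h : ∀ r b x, φ (act r b) x = φ b (r • x)) (b : B) (x : X) :
    bmkLift act φ h (bmk act b x) = φ b x := rfl

/-- A balanced biadditive map that is linear in the first variable. -/
def bmkLiftLinear [Module S G] (φ : B →+ X →+ G) (h : ∀ r b x, φ (act r b) x = φ b (r • x))
    (hφ : ∀ (s : S) b x, φ (s • b) x = s • φ b x) : BimoduleTensor act X →ₗ[S] G :=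
  { bmkLift act φ h with
    map_smul' := fun s w => by
      show bmkLift act φ h (s • w) = s • bmkLift act φ h w
      induction w using bmk_induction with
      | h0 => rw [smul_zero, map_zero, smul_zero]
      | h1 b x => rw [smul_bmk, bmkLift_bmk, bmkLift_bmk, hφ]
      | h2 v w hv hw => rw [smul_add, map_add, hv, hw, map_add, smul_add] }

/-- A splitting of the free `R`-module on `X` onto `X` becomes, after tensoring with `B`, a
splitting of `X →₀ B` onto the tensor product; `X →₀ B` is `S`-projective because `B` is. -/
theorem bimoduleTensor_projective (hadd : ∀ r r' b, act (r + r') b = act r b + act r' b)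
    (hmul : ∀ r r' b, act (r * r') b = act r' (act r b)) [Module.Projective S B]
    [Module.Projective R X] : Module.Projective S (BimoduleTensor act X) := by
  obtain ⟨s, hs⟩ := Module.projective_def'.1 (inferInstance : Module.Projective R X)
  have hs' : ∀ x, (s x).sum (fun y r => r • y) = x := fun x => LinearMap.congr_fun hs x
  have h0 : ∀ b, act 0 b = 0 := fun b => by simpa using hadd 0 0 b
  let ψ : B → (X →₀ R) →+ (X →₀ B) := fun b =>
    Finsupp.mapRange.addMonoidHom (AddMonoidHom.mk' (fun r => act r b) fun r r' => hadd r r' b)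
  have hψ : ∀ b g y, ψ b g y = act (g y) b := fun b g y => rfl
  let φ : B →+ X →+ (X →₀ B) := AddMonoidHom.mk' (fun b => (ψ b).comp s.toAddMonoidHom)
    fun b c => AddMonoidHom.ext fun x => Finsupp.ext fun y => map_add (act (s x y)) b c
  have hφ : ∀ b x y, φ b x y = act (s x y) b := fun b x y => rfl
  let i : BimoduleTensor act X →ₗ[S] (X →₀ B) := bmkLiftLinear act φ
    (fun r b x => Finsupp.ext fun y => by
      rw [hφ, hφ, map_smul, Finsupp.smul_apply, smul_eq_mul, hmul])
    (fun a b x => Finsupp.ext fun y => by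
      rw [hφ, Finsupp.smul_apply, hφ, map_smul])
  let p : (X →₀ B) →ₗ[S] BimoduleTensor act X := Finsupp.lsum ℕ fun y =>
    { toFun := fun b => bmk act b y
      map_add' := fun b c => add_bmk act b c y
      map_smul' := fun a b => (smul_bmk act a b y).symm }
  classical
  have : Module.Projective S (X →₀ B) :=
    Module.Projective.of_equiv (finsuppLequivDFinsupp (ι := X) (M := B) S).symm
  refine Module.Projective.of_split i p (LinearMap.ext fun w => ?_)
  show p (i w) = w
  induction w using bmk_induction with
  | h0 => rw [map_zero, map_zero]
  | h2 v w hv hw => rw [map_add, map_add, hv, hw]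
  | h1 b x =>
    have h1 : i (bmk act b x) = (s x).mapRange (fun r => act r b) (h0 b) := rfl
    have h2 : p (i (bmk act b x)) = (s x).sum fun y r => bmk act (act r b) y := by
      rw [h1]
      show Finsupp.sum _ _ = _
      exact Finsupp.sum_mapRange_index fun y => map_zero ((AddMonoidHom.flip (bmkHom act)) y)
    rw [h2]
    conv_rhs => rw [← hs' x]
    simp only [act_bmk]
    exact (map_finsuppSum (bmkHom act b) (s x) fun y r => r • y).symm

end BimoduleTensor

/-! ### Trivial extensions by a bimodule with `I ⊗_R I = 0` -/

section SplitExtension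

variable {R S : Type u} [Ring R] [Ring S] (ι : R →+* S) (π : S →+* R)

/-- The right action of `R` on `S`. -/
def rightAct (r : R) : S →ₗ[S] S := LinearMap.toSpanSingleton S S (ι r)

theorem rightAct_apply (r : R) (s : S) : rightAct ι r s = s * ι r := rfl

/-- The right action of `R` on the kernel of `π`. -/
def kerRightAct (r : R) : RingHom.ker π →ₗ[S] RingHom.ker π :=
  (rightAct ι r).restrict fun s hs => by
    have hs : π s = 0 := hs
    show π (s * ι r) = 0
    rw [map_mul, hs, zero_mul]

/-- `S` is the trivial extension of `R` by a bimodule `I = ker π` that satisfies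
`I ⊗_R I = 0`. -/
structure IsTrivialExtension : Prop where
  section_apply : ∀ r, π (ι r) = r
  mul_eq_zero : ∀ a b : RingHom.ker π, a.1 * b.1 = 0
  balanced_eq_zero : ∀ (G : Type u) [AddCommGroup G] (φ : RingHom.ker π →+ RingHom.ker π →+ G),
    (∀ (r : R) (a b : RingHom.ker π), φ (kerRightAct ι π r a) b = φ a (ι r • b)) →
      ∀ a b, φ a b = 0

variable {ι π} (h : IsTrivialExtension ι π)

include h

theorem IsTrivialExtension.sub_mem (s : S) : s - ι (π s) ∈ RingHom.ker π := by
  rw [RingHom.mem_ker, map_sub, h.section_apply, sub_self]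

/-- The component of an element in the kernel. -/
def IsTrivialExtension.kerPart (s : S) : RingHom.ker π := ⟨s - ι (π s), h.sub_mem s⟩

theorem IsTrivialExtension.exists_decomposition (s : S) : ∃ j : RingHom.ker π, s = ι (π s) + j :=
  ⟨h.kerPart s, by simp [kerPart]⟩

/-- Lift over `R` to obtain `l`. The pairing `(a, b) ↦ a • l b` on `I` is balanced, hence zero. So
`I` annihilates the image of `l` as well as `I` itself, and `l` is already `S`-linear. -/
theorem IsTrivialExtension.projective_ker [Module R (RingHom.ker π)]
    (hR : ∀ (r : R) (a : RingHom.ker π), r • a = ι r • a)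
    [Module.Projective R (RingHom.ker π)] : Module.Projective S (RingHom.ker π) := by
  refine Module.Projective.of_lifting_property (P := RingHom.ker π) fun {M N} _ _ _ _ p g hp => ?_
  let _ : Module R M := Module.compHom M ι
  let _ : Module R N := Module.compHom N ι
  let p' : M →ₗ[R] N :=
    { toFun := p, map_add' := map_add p, map_smul' := fun r x => map_smul p (ι r) x }
  let g' : RingHom.ker π →ₗ[R] N :=
    { toFun := g
      map_add' := map_add g
      map_smul' := fun r x => by rw [hR]; exact map_smul g (ι r) x }
  obtain ⟨l, hl⟩ := Module.projective_lifting_property p' g' hp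
  have hz : ∀ a b : RingHom.ker π, a.1 • l b = 0 := by
    let φ : RingHom.ker π →+ RingHom.ker π →+ M := AddMonoidHom.mk'
      (fun a => AddMonoidHom.mk' (fun b => a.1 • l b) fun b c => by rw [map_add, smul_add])
      fun a b => AddMonoidHom.ext fun c => add_smul a.1 b.1 (l c)
    refine h.balanced_eq_zero M φ fun r a b => ?_
    show (a.1 * ι r) • l b = a.1 • l (ι r • b)
    rw [← hR, map_smul, mul_smul]
    rfl
  refine ⟨{ toFun := l, map_add' := map_add l, map_smul' := fun s a => ?_ }, ?_⟩
  · obtain ⟨j, hj⟩ := h.exists_decomposition s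
    have h1 : s • a = π s • a := by
      rw [hR]
      refine Subtype.ext ?_
      show s * a.1 = ι (π s) * a.1
      conv_lhs => rw [hj, add_mul, h.mul_eq_zero, add_zero]
    rw [h1, map_smul, RingHom.id_apply]
    show ι (π s) • l a = s • l a
    conv_rhs => rw [hj, add_smul, hz, add_zero]
  · exact LinearMap.ext fun x => LinearMap.congr_fun hl x

/-- The sequence `0 → I ⊗_R Z → S ⊗_R Z → Z → 0`. -/
theorem IsTrivialExtension.ses (Z : ModuleCat.{u} S) [Module R Z]
    (hR : ∀ (r : R) (z : Z), r • z = ι r • z) :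
    SES (ModuleCat.of S (BimoduleTensor (kerRightAct ι π) Z))
      (ModuleCat.of S (BimoduleTensor (rightAct ι) Z)) Z := by
  have hzero : ∀ (a b : RingHom.ker π) (z : Z), bmk (rightAct ι) a.1 (b.1 • z) = 0 := by
    intro a b z
    let φ : RingHom.ker π →+ RingHom.ker π →+ BimoduleTensor (rightAct ι) Z := AddMonoidHom.mk'
      (fun a => AddMonoidHom.mk' (fun b => bmk (rightAct ι) a.1 (b.1 • z)) fun b c => by
        rw [Submodule.coe_add, add_smul, bmk_add])
      fun a b => AddMonoidHom.ext fun c => add_bmk _ a.1 b.1 _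
    refine h.balanced_eq_zero _ φ (fun r a b => ?_) a b
    show bmk (rightAct ι) (rightAct ι r a.1) (b.1 • z) = bmk (rightAct ι) a.1 ((ι r * b.1) • z)
    rw [act_bmk, hR, mul_smul]
  let φg : S →+ Z →+ Z := AddMonoidHom.mk' (fun s => AddMonoidHom.mk' (fun z => s • z) (smul_add s))
    fun s t => AddMonoidHom.ext fun z => add_smul s t z
  let g : BimoduleTensor (rightAct ι) Z →ₗ[S] Z := bmkLiftLinear (rightAct ι) φg
    (fun r s z => by
      show (s * ι r) • z = s • r • z
      rw [hR, mul_smul])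
    fun s t z => mul_smul s t z
  have hg : ∀ s z, g (bmk (rightAct ι) s z) = s • z := fun _ _ => rfl
  -- The term `1 ⊗ a z` puts the image in the kernel of multiplication. `S`-linearity holds because
  -- `I` acts as zero on both sides, by `I * I = 0` and `hzero`.
  let φf : RingHom.ker π →+ Z →+ BimoduleTensor (rightAct ι) Z := AddMonoidHom.mk'
    (fun a => AddMonoidHom.mk'
      (fun z => bmk (rightAct ι) a.1 z - bmk (rightAct ι) 1 (a.1 • z)) fun y z => by
        rw [smul_add, bmk_add, bmk_add]; abel)
    fun a b => AddMonoidHom.ext fun z => by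
      show bmk (rightAct ι) (a.1 + b.1) z - bmk (rightAct ι) 1 ((a.1 + b.1) • z) =
        (bmk (rightAct ι) a.1 z - bmk (rightAct ι) 1 (a.1 • z)) +
          (bmk (rightAct ι) b.1 z - bmk (rightAct ι) 1 (b.1 • z))
      rw [add_smul, bmk_add, add_bmk]; abel
  let f : BimoduleTensor (kerRightAct ι π) Z →ₗ[S] BimoduleTensor (rightAct ι) Z :=
    bmkLiftLinear (kerRightAct ι π) φf
      (fun r a z => by
        show bmk (rightAct ι) (rightAct ι r a.1) z - bmk (rightAct ι) 1 ((a.1 * ι r) • z) =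
          bmk (rightAct ι) a.1 (r • z) - bmk (rightAct ι) 1 (a.1 • r • z)
        rw [act_bmk, mul_smul, hR])
      fun s a z => by
        show bmk (rightAct ι) (s * a.1) z - bmk (rightAct ι) 1 ((s * a.1) • z) =
          s • (bmk (rightAct ι) a.1 z - bmk (rightAct ι) 1 (a.1 • z))
        rw [smul_sub, smul_bmk, smul_bmk, smul_eq_mul, smul_eq_mul, mul_one, sub_right_inj]
        obtain ⟨j, hj⟩ := h.exists_decomposition s
        have h1 : s * a.1 = ι (π s) * a.1 := by
          conv_lhs => rw [hj, add_mul, h.mul_eq_zero, add_zero]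
        have h2 : bmk (rightAct ι) s (a.1 • z) = bmk (rightAct ι) (ι (π s)) (a.1 • z) := by
          conv_lhs => rw [hj, add_bmk, hzero, add_zero]
        have h3 : ι (π s) = rightAct ι (π s) 1 := by rw [rightAct_apply, one_mul]
        rw [h1, h2, mul_smul, ← hR, ← act_bmk, ← h3]
  have hf : ∀ a z, f (bmk (kerRightAct ι π) a z) =
    bmk (rightAct ι) a.1 z - bmk (rightAct ι) 1 (a.1 • z) := fun _ _ => rfl
  -- Replacing `s` by its component in `I` gives a left inverse `u` of `f`; with the section `z ↦ 1
  -- ⊗ z` of `g` it is an additive splitting, which yields exactness.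
  let φu : S →+ Z →+ BimoduleTensor (kerRightAct ι π) Z := AddMonoidHom.mk'
    (fun s => AddMonoidHom.mk' (bmk (kerRightAct ι π) (h.kerPart s)) (bmk_add _ _))
    fun s t => AddMonoidHom.ext fun z => by
      have h1 : h.kerPart (s + t) = h.kerPart s + h.kerPart t := Subtype.ext (by
        show s + t - ι (π (s + t)) = (s - ι (π s)) + (t - ι (π t))
        rw [map_add, map_add]; abel)
      show bmk (kerRightAct ι π) (h.kerPart (s + t)) z = _
      rw [h1, add_bmk]
      rfl
  let u : BimoduleTensor (rightAct ι) Z →+ BimoduleTensor (kerRightAct ι π) Z :=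
    bmkLift (rightAct ι) φu fun r s z => by
      have h1 : h.kerPart (s * ι r) = kerRightAct ι π r (h.kerPart s) := Subtype.ext (by
        show s * ι r - ι (π (s * ι r)) = (s - ι (π s)) * ι r
        rw [map_mul, map_mul, h.section_apply, sub_mul])
      show bmk (kerRightAct ι π) (h.kerPart (s * ι r)) z = bmk (kerRightAct ι π) (h.kerPart s) (r • z)
      rw [h1, act_bmk]
  have hu : ∀ s z, u (bmk (rightAct ι) s z) = bmk (kerRightAct ι π) (h.kerPart s) z :=
    fun _ _ => rfl
  have huf : ∀ w, u (f w) = w := by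
    intro w
    induction w using bmk_induction with
    | h0 => rw [map_zero, map_zero]
    | h2 v w hv hw => rw [map_add, map_add, hv, hw]
    | h1 a z =>
      have ha : π a.1 = 0 := a.2
      have h1 : h.kerPart a.1 = a := Subtype.ext (by
        show a.1 - ι (π a.1) = a.1
        rw [ha, map_zero, sub_zero])
      have h2 : h.kerPart 1 = 0 := Subtype.ext (by
        show 1 - ι (π 1) = 0
        rw [map_one, map_one, sub_self])
      rw [hf, map_sub, hu, hu, h1, h2, sub_eq_self]
      exact congrArg (fun k => k (a.1 • z)) (map_zero (bmkHom (X := Z) (kerRightAct ι π)))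
  have hfu : ∀ w, f (u w) + bmk (rightAct ι) 1 (g w) = w := by
    intro w
    induction w using bmk_induction with
    | h0 =>
      rw [map_zero, map_zero, map_zero, zero_add]
      exact map_zero (bmkHom (X := Z) (rightAct ι) 1)
    | h2 v w hv hw =>
      rw [map_add, map_add, map_add, bmk_add]
      conv_rhs => rw [← hv, ← hw]
      abel
    | h1 s z =>
      have h1 : bmk (rightAct ι) (ι (π s)) z = bmk (rightAct ι) 1 (ι (π s) • z) := by
        rw [← hR, ← act_bmk, rightAct_apply, one_mul]
      have h2 : s = (h.kerPart s).1 + ι (π s) := by simp [kerPart]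
      rw [hu, hf, hg]
      conv_rhs => rw [h2, add_bmk, h1]
      have h3 : s • z = (h.kerPart s).1 • z + ι (π s) • z := by rw [← add_smul, ← h2]
      rw [h3, bmk_add]
      abel
  refine ⟨f, g, Function.LeftInverse.injective huf, fun z => ⟨bmk _ 1 z, by rw [hg, one_smul]⟩,
    fun w => ⟨fun hw => ⟨u w, ?_⟩, ?_⟩⟩
  · have := hfu w
    have h0 : bmk (rightAct ι) (1 : S) (0 : Z) = 0 := map_zero (bmkHom (X := Z) (rightAct ι) 1)
    rwa [hw, h0, add_zero] at this
  · rintro ⟨v, rfl⟩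
    induction v using bmk_induction with
    | h0 => rw [map_zero, map_zero]
    | h2 v w hv hw => rw [map_add, map_add, hv, hw, add_zero]
    | h1 a z => rw [hf, map_sub, hg, hg, one_smul, sub_self]

theorem IsTrivialExtension.projective_ring [Module R S] (hRS : ∀ (r : R) (s : S), r • s = ι r * s)
    [Module R (RingHom.ker π)] (hR : ∀ (r : R) (a : RingHom.ker π), r • a = ι r • a)
    [Module.Projective R (RingHom.ker π)] : Module.Projective R S :=
  Module.Projective.of_split (M := R × RingHom.ker π)
    { toFun := fun s => (π s, h.kerPart s)
      map_add' := fun s t => Prod.ext (map_add π s t) (Subtype.ext (by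
        show s + t - ι (π (s + t)) = (s - ι (π s)) + (t - ι (π t))
        rw [map_add, map_add]; abel))
      map_smul' := fun r s => by
        rw [RingHom.id_apply, hRS]
        refine Prod.ext ?_ ?_
        · show π (ι r * s) = r * π s
          rw [map_mul, h.section_apply]
        · show h.kerPart (ι r * s) = r • h.kerPart s
          rw [hR]
          refine Subtype.ext ?_
          show ι r * s - ι (π (ι r * s)) = ι r * (s - ι (π s))
          rw [map_mul, map_mul, h.section_apply, mul_sub] }
    { toFun := fun x => ι x.1 + x.2.1
      map_add' := fun x y => by
        show ι (x.1 + y.1) + (x.2.1 + y.2.1) = _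
        rw [map_add]; abel
      map_smul' := fun r x => by
        rw [RingHom.id_apply, hRS, mul_add, ← map_mul]
        show ι (r * x.1) + (r • x.2).1 = _
        rw [hR]
        rfl }
    (LinearMap.ext fun s => by
      show ι (π s) + (s - ι (π s)) = s
      abel)

/-- For `Z` projective over `R`, the modules `I ⊗_R Z` and `S ⊗_R Z` are projective over `S`, so
`ses` is a resolution of length one. Dimension shifting does the rest. -/
theorem IsTrivialExtension.hasProjectiveDimensionLE_succ [Module R (RingHom.ker π)]
    (hR : ∀ (r : R) (a : RingHom.ker π), r • a = ι r • a)
    [Module.Projective R (RingHom.ker π)] (n : ℕ) (Z : ModuleCat.{u} S)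
    (hZ : HasProjectiveDimensionLE (res ι Z) n) : HasProjectiveDimensionLE Z (n + 1) := by
  let _ : Module R S := Module.compHom S ι
  have hRS : ∀ (r : R) (s : S), r • s = ι r * s := fun _ _ => rfl
  have := h.projective_ring hRS hR
  induction n generalizing Z with
  | zero =>
    rw [← projective_iff_hasProjectiveDimensionLE_zero, projective_iff] at hZ
    let _ : Module R Z := Module.compHom Z ι
    have hZ : Module.Projective R Z := hZ
    have := h.projective_ker hR
    refine ((h.ses Z fun _ _ => rfl).hasProjectiveDimensionLE_iff ?_ 0).2 ?_
    · refine (projective_iff _).2 (bimoduleTensor_projective _ (fun r r' s => ?_) fun r r' s => ?_)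
      · simp only [rightAct_apply, map_add, mul_add]
      · simp only [rightAct_apply, map_mul, mul_assoc]
    · rw [← projective_iff_hasProjectiveDimensionLE_zero]
      refine (projective_iff _).2 (bimoduleTensor_projective _ (fun r r' s => ?_) fun r r' s => ?_)
      · refine Subtype.ext ?_
        show s.1 * ι (r + r') = s.1 * ι r + s.1 * ι r'
        rw [map_add, mul_add]
      · refine Subtype.ext ?_
        show s.1 * ι (r * r') = s.1 * ι r * ι r'
        rw [map_mul, mul_assoc]
  | succ n ih =>
    obtain ⟨K, F, hF, hS⟩ := exists_ses_projective Z
    exact (hS.hasProjectiveDimensionLE_iff hF (n + 1)).2 (ih K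
      (((hS.res ι).hasProjectiveDimensionLE_iff (projective_res ι hRS F hF) n).1 hZ))

/-- The finitistic dimensions of a ring and of its trivial extension. -/
theorem IsTrivialExtension.finDim_le [Module R (RingHom.ker π)]
    (hR : ∀ (r : R) (a : RingHom.ker π), r • a = ι r • a)
    [Module.Projective R (RingHom.ker π)] [Module R S]
    (hRS : ∀ (r : R) (s : S), r • s = ι r * s) [Module.Finite R S] :
    finDim R ≤ finDim S ∧ finDim S ≤ finDim R + 1 := by
  have hproj := h.projective_ring hRS hR
  constructor
  · by_cases ht : finDim S = ⊤
    · rw [ht]; exact le_top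
    obtain ⟨n, hn⟩ := ENat.ne_top_iff_exists.1 ht
    rw [← hn, finDim_le_iff]
    intro X hX ⟨k, hk⟩
    have hπ : Function.Surjective π := fun r => ⟨ι r, h.section_apply r⟩
    -- Inflating along `π` and restricting along `ι` returns `X`, since `π ∘ ι` is the identity. The
    -- intermediate bound `k + 1` only serves to make the dimension over `S` finite.
    let e' : res ι (res π X) ≃ₗ[R] X :=
      { toFun := fun x => x
        invFun := fun x => x
        map_add' := fun _ _ => rfl
        map_smul' := fun r x => by
          show (π (ι r) • (show X from x) : X) = r • (show X from x)
          rw [h.section_apply]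
        left_inv := fun _ => rfl
        right_inv := fun _ => rfl }
    let e : res ι (res π X) ≅ X := e'.toModuleIso
    have hk' := h.hasProjectiveDimensionLE_succ hR k (res π X)
      (hasProjectiveDimensionLT_of_iso e.symm (k + 1))
    let _ : Module S R := Module.compHom R π
    have hSR : ∀ (s : S) (r : R), s • r = π s * r := fun _ _ => rfl
    have : Module.Finite S R := Module.Finite.of_surjective (M := S)
      { toFun := π
        map_add' := map_add π
        map_smul' := fun s a => by rw [RingHom.id_apply, hSR, smul_eq_mul, map_mul] } hπ
    have hn' := (finDim_le_iff n).1 hn.symm.le (res π X) (fg_res π hSR hX) ⟨k + 1, hk'⟩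
    have := hasProjectiveDimensionLE_res ι hRS n _ hn'
    exact hasProjectiveDimensionLT_of_iso e (n + 1)
  · by_cases ht : finDim R = ⊤
    · rw [ht]; exact le_top
    obtain ⟨n, hn⟩ := ENat.ne_top_iff_exists.1 ht
    have hn1 : finDim R + 1 = ((n + 1 : ℕ) : ℕ∞) := by rw [← hn]; rfl
    rw [hn1, finDim_le_iff]
    intro Z hZ ⟨k, hk⟩
    exact h.hasProjectiveDimensionLE_succ hR n Z ((finDim_le_iff n).1 hn.symm.le _
      (fg_res ι hRS hZ) ⟨k, hasProjectiveDimensionLE_res ι hRS k Z hk⟩)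

end SplitExtension

end GLIT

/-! ### The Morita ring as a trivial extension of `T × U` -/

namespace GLIT

theorem IsArtinAlgebra.isArtinianRing {A : Type u} [Ring A] (h : IsArtinAlgebra A) :
    IsArtinianRing A := by
  obtain ⟨k, _, _, _, _⟩ := h
  have : IsArtinian k A := isArtinian_of_fg_of_artinian'
  exact isArtinian_of_tower k this

/-- Balanced biadditive maps vanish when the tensor product is zero. -/
theorem eq_zero_of_balanced {A P Q G : Type u} [Ring A] [AddCommGroup P] [AddCommGroup Q]
    [Module Aᵐᵒᵖ P] [Module A Q] [AddCommGroup G] (h : Subsingleton (BalancedTensor A P Q))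
    (φ : P →+ Q →+ G) (hφ : ∀ (p : P) (a : A) (q : Q), φ (MulOpposite.op a • p) q = φ p (a • q))
    (p : P) (q : Q) : φ p q = 0 := by
  let ψ : TensorProduct ℤ P Q →+ G := TensorProduct.liftAddHom φ fun n p q => by simp
  have hψ : ∀ p q, ψ (TensorProduct.tmul ℤ p q) = φ p q := fun _ _ => rfl
  have h0 : btmul A p q = 0 := Subsingleton.elim _ _
  have h1 := (QuotientAddGroup.eq_zero_iff _).1 h0
  have h2 : AddSubgroup.closure {x : TensorProduct ℤ P Q | ∃ (m : P) (t : A) (n : Q),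
      x = TensorProduct.tmul ℤ (MulOpposite.op t • m) n - TensorProduct.tmul ℤ m (t • n)} ≤
      ψ.ker := by
    rw [AddSubgroup.closure_le]
    rintro _ ⟨p, a, q, rfl⟩
    show ψ _ = 0
    rw [map_sub, hψ, hψ, hφ, sub_self]
  exact h2 h1

section Morita

variable {T N M U : Type u} [Ring T] [Ring U] [AddCommGroup M] [AddCommGroup N]
  [Module U M] [Module Tᵐᵒᵖ M] [SMulCommClass U Tᵐᵒᵖ M]
  [Module T N] [Module Uᵐᵒᵖ N] [SMulCommClass T Uᵐᵒᵖ N]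
  (c : MoritaContext T N M U)

/-- The inclusion of the diagonal matrices. -/
def diagonalHom : T × U →+* MoritaRing c where
  toFun x := ⟨x.1, 0, 0, x.2⟩
  map_one' := rfl
  map_mul' x y := by ext <;> simp [btmul_zero]
  map_zero' := rfl
  map_add' x y := by ext <;> simp

theorem diagonalHom_mul (r : T × U) (x : MoritaRing c) :
    diagonalHom c r * x = ⟨r.1 * x.t, r.1 • x.n, r.2 • x.m, r.2 * x.u⟩ := by
  ext <;> simp [diagonalHom, zero_btmul]

theorem mul_diagonalHom (r : T × U) (x : MoritaRing c) :
    x * diagonalHom c r =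
      ⟨x.t * r.1, MulOpposite.op r.2 • x.n, MulOpposite.op r.1 • x.m, x.u * r.2⟩ := by
  ext <;> simp [diagonalHom, btmul_zero]

variable (hMN : Subsingleton (BalancedTensor T M N)) (hNM : Subsingleton (BalancedTensor U N M))

/-- The projection to the diagonal entries. -/
def diagonalPart : MoritaRing c →+* T × U where
  toFun x := (x.t, x.u)
  map_one' := rfl
  map_mul' x y := by
    refine Prod.ext ?_ ?_
    · simp [Subsingleton.elim (btmul U x.n y.m) 0]
    · simp [Subsingleton.elim (btmul T x.m y.n) 0]
  map_zero' := rfl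
  map_add' x y := rfl

theorem mem_ker_diagonalPart {x : MoritaRing c} :
    x ∈ RingHom.ker (diagonalPart c hMN hNM) ↔ x.t = 0 ∧ x.u = 0 := Prod.ext_iff

/-- Off-diagonal matrices. -/
def offDiagonal : N × M →+ RingHom.ker (diagonalPart c hMN hNM) where
  toFun x := ⟨⟨0, x.1, x.2, 0⟩, rfl⟩
  map_zero' := rfl
  map_add' x y := Subtype.ext (by ext <;> simp)

theorem offDiagonal_eq (a : RingHom.ker (diagonalPart c hMN hNM)) :
    offDiagonal c hMN hNM (a.1.n, a.1.m) = a :=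
  Subtype.ext (MoritaRing.ext ((mem_ker_diagonalPart c hMN hNM).1 a.2).1.symm rfl rfl
    ((mem_ker_diagonalPart c hMN hNM).1 a.2).2.symm)

theorem diagonalHom_smul_offDiagonal (r : T × U) (x : N × M) :
    diagonalHom c r • offDiagonal c hMN hNM x = offDiagonal c hMN hNM (r.1 • x.1, r.2 • x.2) := by
  refine Subtype.ext ?_
  show diagonalHom c r * ⟨0, x.1, x.2, 0⟩ = _
  rw [diagonalHom_mul, mul_zero, mul_zero]
  rfl

theorem kerRightAct_offDiagonal (r : T × U) (x : N × M) :
    kerRightAct (diagonalHom c) (diagonalPart c hMN hNM) r (offDiagonal c hMN hNM x) =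
      offDiagonal c hMN hNM (MulOpposite.op r.2 • x.1, MulOpposite.op r.1 • x.2) := by
  refine Subtype.ext ?_
  show (⟨0, x.1, x.2, 0⟩ : MoritaRing c) * diagonalHom c r = _
  rw [mul_diagonalHom, zero_mul, zero_mul]
  rfl

/-- A balanced pairing on `N ⊕ M` has four components. The mixed ones vanish by hypothesis. On `N ×
N` the idempotent `(0, 1)` acts as the identity from the right and as zero from the left, so moving
it across kills the pairing; likewise `(1, 0)` on `M × M`. -/
theorem isTrivialExtension_moritaRing :
    IsTrivialExtension (diagonalHom c) (diagonalPart c hMN hNM) where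
  section_apply _ := rfl
  mul_eq_zero a b := by
    obtain ⟨ht, hu⟩ := (mem_ker_diagonalPart c hMN hNM).1 a.2
    obtain ⟨ht', hu'⟩ := (mem_ker_diagonalPart c hMN hNM).1 b.2
    ext
    · simp [ht, Subsingleton.elim (btmul U a.1.n b.1.m) 0]
    · simp [ht, hu']
    · simp [hu, ht']
    · simp [hu, Subsingleton.elim (btmul T a.1.m b.1.n) 0]
  balanced_eq_zero G _ φ hφ := by
    let φ' : N × M →+ N × M →+ G :=
      (AddMonoidHom.compHom.flip (offDiagonal c hMN hNM)).comp (φ.comp (offDiagonal c hMN hNM))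
    have hφ' : ∀ x y, φ' x y = φ (offDiagonal c hMN hNM x) (offDiagonal c hMN hNM y) :=
      fun _ _ => rfl
    have hbal : ∀ (r : T × U) x y,
        φ' (MulOpposite.op r.2 • x.1, MulOpposite.op r.1 • x.2) y =
          φ' x (r.1 • y.1, r.2 • y.2) := fun r x y => by
      rw [hφ', hφ', ← kerRightAct_offDiagonal, hφ, diagonalHom_smul_offDiagonal]
    have hz : ∀ x, φ' x (0, 0) = 0 := fun x => map_zero (φ' x)
    have hNN : ∀ n n' : N, φ' (n, 0) (n', 0) = 0 := fun n n' => by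
      have := hbal (0, 1) (n, 0) (n', 0)
      simpa [hz] using this
    have hMM : ∀ m m' : M, φ' (0, m) (0, m') = 0 := fun m m' => by
      have := hbal (1, 0) (0, m) (0, m')
      simpa [hz] using this
    have hMN' : ∀ (m : M) (n : N), φ' (0, m) (n, 0) = 0 :=
      eq_zero_of_balanced hMN ((AddMonoidHom.compHom.flip (AddMonoidHom.inl N M)).comp
        (φ'.comp (AddMonoidHom.inr N M))) fun m t n => by
          have := hbal (t, 0) (0, m) (n, 0)
          simpa using this
    have hNM' : ∀ (n : N) (m : M), φ' (n, 0) (0, m) = 0 :=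
      eq_zero_of_balanced hNM ((AddMonoidHom.compHom.flip (AddMonoidHom.inr N M)).comp
        (φ'.comp (AddMonoidHom.inl N M))) fun n u m => by
          have := hbal (0, u) (n, 0) (0, m)
          simpa using this
    intro a b
    rw [← offDiagonal_eq c hMN hNM a, ← offDiagonal_eq c hMN hNM b, ← hφ']
    have hs : ∀ (n : N) (m : M), (n, m) = (n, 0) + (0, m) := fun n m => by simp
    rw [hs a.1.n, hs b.1.n, map_add, map_add, AddMonoidHom.add_apply, AddMonoidHom.add_apply,
      hNN, hMN', hNM', hMM]
    simp

theorem projective_ker_diagonalPart [Module.Projective T N] [Module.Projective U M]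
    [Module (T × U) (RingHom.ker (diagonalPart c hMN hNM))]
    (hR : ∀ (r : T × U) (a : RingHom.ker (diagonalPart c hMN hNM)), r • a = diagonalHom c r • a) :
    Module.Projective (T × U) (RingHom.ker (diagonalPart c hMN hNM)) := by
  let _ : Module (T × U) T := Module.compHom T (RingHom.fst T U)
  let _ : Module (T × U) U := Module.compHom U (RingHom.snd T U)
  have hT := (isDirectFactor_fst T U).projective fun _ _ => rfl
  have hU := (isDirectFactor_snd T U).projective fun _ _ => rfl
  let N' := res (RingHom.fst T U) (ModuleCat.of T N)
  let M' := res (RingHom.snd T U) (ModuleCat.of U M)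
  have hN : Module.Projective (T × U) N' := (projective_iff _).1
    (projective_res (RingHom.fst T U) (fun _ _ => rfl) (ModuleCat.of T N)
      ((projective_iff _).2 ‹_›))
  have hM : Module.Projective (T × U) M' := (projective_iff _).1
    (projective_res (RingHom.snd T U) (fun _ _ => rfl) (ModuleCat.of U M)
      ((projective_iff _).2 ‹_›))
  let p : (N' × M') →ₗ[T × U] RingHom.ker (diagonalPart c hMN hNM) :=
    { toFun := offDiagonal c hMN hNM
      map_add' := map_add (offDiagonal c hMN hNM)
      map_smul' := fun r x => by
        rw [RingHom.id_apply, hR]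
        exact (diagonalHom_smul_offDiagonal c hMN hNM r x).symm }
  have hp : Function.Bijective p :=
    ⟨fun x y hxy => Prod.ext (congrArg (fun a => a.1.n) hxy) (congrArg (fun a => a.1.m) hxy),
      fun a => ⟨(a.1.n, a.1.m), offDiagonal_eq c hMN hNM a⟩⟩
  exact Module.Projective.of_equiv (LinearEquiv.ofBijective p hp)

/-- Scalars from the ground ring are central, and commuting with `diag(1, 0)` forces a matrix to be
diagonal. Generators over the ground ring therefore generate over `T × U`. -/
theorem finite_moritaRing [Module (T × U) (MoritaRing c)]
    (hRS : ∀ (r : T × U) (x : MoritaRing c), r • x = diagonalHom c r * x)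
    (h : IsArtinAlgebra (MoritaRing c)) : Module.Finite (T × U) (MoritaRing c) := by
  obtain ⟨k, _, _, _, _⟩ := h
  have hk : ∀ a : k, algebraMap k (MoritaRing c) a =
      diagonalHom c ((algebraMap k (MoritaRing c) a).t, (algebraMap k (MoritaRing c) a).u) := by
    intro a
    have := Algebra.commutes a (diagonalHom c (1, 0))
    rw [mul_diagonalHom, diagonalHom_mul] at this
    refine MoritaRing.ext rfl ?_ ?_ rfl
    · have := congrArg MoritaRing.n this
      simpa [diagonalHom] using this.symm
    · have := congrArg MoritaRing.m this
      simpa [diagonalHom] using this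
  obtain ⟨s, hs⟩ := Module.Finite.fg_top (R := k) (M := MoritaRing c)
  refine ⟨s, top_unique fun x _ => ?_⟩
  have hx : x ∈ Submodule.span k (s : Set (MoritaRing c)) := hs ▸ Submodule.mem_top
  induction hx using Submodule.span_induction with
  | mem x hx => exact Submodule.subset_span hx
  | zero => exact zero_mem _
  | add x y _ _ hx hy => exact add_mem (hx trivial) (hy trivial)
  | smul a x _ hx =>
    rw [Algebra.smul_def, hk, ← hRS]
    exact Submodule.smul_mem _ _ (hx trivial)

end Morita

theorem finDim_moritaRing {T N M U : Type u} [Ring T] [Ring U] [AddCommGroup M] [AddCommGroup N]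
    [Module U M] [Module Tᵐᵒᵖ M] [SMulCommClass U Tᵐᵒᵖ M]
    [Module T N] [Module Uᵐᵒᵖ N] [SMulCommClass T Uᵐᵒᵖ N]
    (c : MoritaContext T N M U) (hMN : Subsingleton (BalancedTensor T M N))
    (hNM : Subsingleton (BalancedTensor U N M)) [Module.Projective T N] [Module.Projective U M]
    (hΛ : IsArtinAlgebra (MoritaRing c)) :
    max (finDim T) (finDim U) ≤ finDim (MoritaRing c) ∧
      finDim (MoritaRing c) ≤ max (finDim T) (finDim U) + 1 := by
  let _ : Module (T × U) (RingHom.ker (diagonalPart c hMN hNM)) :=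
    Module.compHom _ (diagonalHom c)
  let _ : Module (T × U) (MoritaRing c) := Module.compHom _ (diagonalHom c)
  have := projective_ker_diagonalPart c hMN hNM fun _ _ => rfl
  have := finite_moritaRing c (fun _ _ => rfl) hΛ
  rw [← finDim_prod]
  exact (isTrivialExtension_moritaRing c hMN hNM).finDim_le (fun _ _ => rfl) fun _ _ => rfl

end GLIT

theorem mainTheorem7
    (T N M U : Type u) [Ring T] [Ring U] [AddCommGroup M] [AddCommGroup N]
    [Module U M] [Module Tᵐᵒᵖ M] [SMulCommClass U Tᵐᵒᵖ M]
    [Module T N] [Module Uᵐᵒᵖ N] [SMulCommClass T Uᵐᵒᵖ N]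
    (c : GLIT.MoritaContext T N M U)
    (hT : GLIT.IsArtinAlgebra T) (hU : GLIT.IsArtinAlgebra U)
    (hΛ : GLIT.IsArtinAlgebra (GLIT.MoritaRing c))
    (hUM : Module.Projective U M) (hMT : Module.Projective Tᵐᵒᵖ M)
    (hTN : Module.Projective T N) (hNU : Module.Projective Uᵐᵒᵖ N)
    (hMN : Subsingleton (GLIT.BalancedTensor T M N))
    (hNM : Subsingleton (GLIT.BalancedTensor U N M)) :
    (GLIT.IsSpecialGLIT (GLIT.MoritaRing c) ↔ GLIT.IsSpecialGLIT T ∧ GLIT.IsSpecialGLIT U) ∧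
    max (GLIT.finDim T) (GLIT.finDim U) ≤ GLIT.finDim (GLIT.MoritaRing c) ∧
    GLIT.finDim (GLIT.MoritaRing c) ≤ max (GLIT.finDim T) (GLIT.finDim U) + 2 := by
  obtain ⟨hle, hle'⟩ := GLIT.finDim_moritaRing c hMN hNM hΛ
  have := hT.isArtinianRing
  have := hU.isArtinianRing
  have := hΛ.isArtinianRing
  -- The trivial extension gives the upper bound with `+ 1`, which is weakened to `+ 2`.
  refine ⟨?_, hle, hle'.trans (by gcongr; exact one_le_two)⟩
  rw [GLIT.isSpecialGLIT_iff_finDim_ne_top, GLIT.isSpecialGLIT_iff_finDim_ne_top,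
    GLIT.isSpecialGLIT_iff_finDim_ne_top]
  refine ⟨fun h => ⟨ne_top_of_le_ne_top h ((le_max_left _ _).trans hle),
    ne_top_of_le_ne_top h ((le_max_right _ _).trans hle)⟩, fun ⟨h, h'⟩ => ?_⟩
  refine ne_top_of_le_ne_top (WithTop.add_ne_top.2 ⟨?_, ENat.one_ne_top⟩) hle'
  rcases max_choice (GLIT.finDim T) (GLIT.finDim U) with h1 | h1 <;> rw [h1] <;> assumption
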